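/- Let $(M,g)$ be a closed (compact, without boundary) smooth Riemannian manifold of dimension $n\ge 1$, with Riemannian volume $\mathcal V_g$, and let $V:M\to\mathbb R$ be a bounded measurable function with $\inf_M V>0$. Let $H^1(M)$ be the completion of $C^\infty(M)$ for the norm $\|u\|_{H^1}^2=\int_M u^2\,d\mathcal V_g+\int_M|du|^2\,d\mathcal V_g$, and for $u\in H^1(M)$ put $$Q(u)=\int_M |du|^2\,d\mathcal V_g+\int_M V u^2\,d\mathcal V_g .$$ Let $\lambda_1(M)$ be the first (smallest) eigenvalue of the Schrödinger operator $-\Delta_g+V$, where a nonzero $u\in H^1(M)$ is an eigenfunction with eigenvalue $\lambda$ if $\int_M\langle du,dv\rangle\,d\mathcal V_g+\int_M Vuv\,d\mathcal V_g=\lambda\int_M uv\,d\mathcal V_g$ for all $v\in H^1(M)$, and let $e_1\in H^1(M)$ be an eigenfunction with eigenvalue $\lambda_1(M)$. For a subset $A\subset M$ let $H^1_0(M-A)$ be the closure in $H^1(M)$ of the set of all $f\in H^1(M)$ that vanish (almost everywhere) on an open neighborhood of $A$, and let $$S_A(M)=\Big\{u\in H^1(M):\ \int_M u\,d\mathcal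 V_g=0,\ u-e_1\in H^1_0(M-A)\Big\},\qquad \mathrm{cap}(A)=\inf_{u\in S_A(M)}Q(u),$$ with $\mathrm{cap}(A)=+\infty$ if $S_A(M)=\emptyset$. A capacity minimizer of $A$ is a function $u_A\in S_A(M)$ with $Q(u_A)=\mathrm{cap}(A)$. **Theorem.** For every subset $A\subset M$: if $S_A(M)\ne\emptyset$, then there is exactly one capacity minimizer $u_A$ of $A$; and every capacity minimizer $u_A$ of $A$ satisfies $$\|u_A\|_{L^2(M)}^2\ \le\ \frac{\mathrm{cap}(A)}{\lambda_1(M)} .$$ -/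

import Mathlib

open MeasureTheory Bundle Manifold
open scoped ContDiff RealInnerProductSpace Matrix

set_option linter.unusedSectionVars false

noncomputable section

namespace Schrodinger

theorem continuousAt_cramer {X : Type*} [TopologicalSpace X] {n : ℕ}
    {Γ : X → Matrix (Fin n) (Fin n) ℝ} {a c : X → Fin n → ℝ} {x : X}
    (hΓ : ContinuousAt Γ x) (ha : ContinuousAt a x) (hc : ContinuousAt c x)
    (h : (Γ x).det ≠ 0) :
    ContinuousAt (fun y => a y ⬝ᵥ (((Γ y).det)⁻¹ • ((Γ y).adjugate *ᵥ c y))) x := by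
  have h1 : ContinuousAt (fun y => (Γ y).det) x :=
    (Continuous.matrix_det (A := fun N : Matrix (Fin n) (Fin n) ℝ => N)
      continuous_id).continuousAt.comp hΓ
  have h2 : ContinuousAt (fun y => (Γ y).adjugate) x :=
    (Continuous.matrix_adjugate (A := fun N : Matrix (Fin n) (Fin n) ℝ => N)
      continuous_id).continuousAt.comp hΓ
  simp only [dotProduct, Pi.smul_apply, Matrix.mulVec, smul_eq_mul]
  refine tendsto_finsetSum _ fun i _ => Filter.Tendsto.mul (continuousAt_pi.1 ha i) ?_
  refine Filter.Tendsto.mul (h1.inv₀ h) (tendsto_finsetSum _ fun j _ => ?_)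
  exact Filter.Tendsto.mul (continuousAt_pi.1 (continuousAt_pi.1 h2 i) j) (continuousAt_pi.1 hc j)

section Geometry

variable (n : ℕ) (M : Type*) [TopologicalSpace M] [ChartedSpace (EuclideanSpace ℝ (Fin n)) M]
  [IsManifold (𝓡 n) ∞ M] [RiemannianBundle (fun x : M => TangentSpace (𝓡 n) x)]

/-- The Gram matrix `(g_ij)` of the metric in the chart around `x`, at the point with
coordinates `y`. -/
def chartGram (x : M) (y : EuclideanSpace ℝ (Fin n)) : Matrix (Fin n) (Fin n) ℝ :=
  Matrix.of fun i j =>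
    ⟪mfderiv 𝓘(ℝ, EuclideanSpace ℝ (Fin n)) (𝓡 n) (extChartAt (𝓡 n) x).symm y
        (EuclideanSpace.single i (1 : ℝ)),
      mfderiv 𝓘(ℝ, EuclideanSpace ℝ (Fin n)) (𝓡 n) (extChartAt (𝓡 n) x).symm y
        (EuclideanSpace.single j (1 : ℝ))⟫

/-- The Riemannian volume measure: on the domain of the chart around `x` it is
`√(det g_ij) dy`.  These measures agree on overlaps of chart domains,
so that their supremum is the measure which restricts to each of them. -/
def riemannianVolume [MeasurableSpace M] : Measure M :=
  ⨆ x : M, Measure.map (extChartAt (𝓡 n) x).symm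
    ((volume.restrict (extChartAt (𝓡 n) x).target).withDensity
      fun y => ENNReal.ofReal √(chartGram n M x y).det)

variable {n M}

instance (x : M) : FiniteDimensional ℝ (TangentSpace (𝓡 n) x) :=
  inferInstanceAs (FiniteDimensional ℝ (EuclideanSpace ℝ (Fin n)))

instance (x : M) : CompleteSpace (TangentSpace (𝓡 n) x) :=
  FiniteDimensional.complete ℝ _

variable (n) in
/-- The differential `dφ_x` as a linear form on the tangent space. -/
def diff (φ : M → ℝ) (x : M) : TangentSpace (𝓡 n) x →L[ℝ] ℝ :=
  mfderiv (𝓡 n) 𝓘(ℝ, ℝ) φ x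

variable (n) in
/-- The Riemannian gradient, dual to the differential; in particular `|∇φ| = |dφ|`. -/
def grad (φ : M → ℝ) (x : M) : TangentSpace (𝓡 n) x :=
  (InnerProductSpace.toDual ℝ (TangentSpace (𝓡 n) x)).symm (diff n φ x)

theorem inner_grad_grad (φ ψ : M → ℝ) (x : M) :
    ⟪grad n φ x, grad n ψ x⟫ = diff n φ x (grad n ψ x) := by
  simp [grad]

theorem continuous_diff_section {φ : M → ℝ} (hφ : ContMDiff (𝓡 n) 𝓘(ℝ, ℝ) ∞ φ) {x : M}
    {s : ∀ y : M, TangentSpace (𝓡 n) y}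
    (hs : ContMDiffAt (𝓡 n) ((𝓡 n).prod 𝓘(ℝ, EuclideanSpace ℝ (Fin n))) ∞
      (fun y => (⟨y, s y⟩ : TangentBundle (𝓡 n) M)) x) :
    ContinuousAt (fun y => diff n φ y (s y)) x := by
  have h1 : Continuous (tangentMap (𝓡 n) 𝓘(ℝ, ℝ) φ) := hφ.continuous_tangentMap (by simp)
  have h2 : Continuous (fun p : TangentBundle 𝓘(ℝ, ℝ) ℝ => (p.2 : ℝ)) :=
    (contMDiff_snd_tangentBundle_modelSpace (n := 0) ℝ 𝓘(ℝ, ℝ)).continuous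
  exact (h2.comp h1).continuousAt.comp hs.continuousAt

theorem continuous_inner_grad
    [IsContMDiffRiemannianBundle (𝓡 n) ∞ (EuclideanSpace ℝ (Fin n))
      (fun x : M => TangentSpace (𝓡 n) x)]
    {φ ψ : M → ℝ} (hφ : ContMDiff (𝓡 n) 𝓘(ℝ, ℝ) ∞ φ) (hψ : ContMDiff (𝓡 n) 𝓘(ℝ, ℝ) ∞ ψ) :
    Continuous fun x => ⟪grad n φ x, grad n ψ x⟫ := by
  rw [continuous_iff_continuousAt]
  intro x
  let e := trivializationAt (EuclideanSpace ℝ (Fin n)) (fun x : M => TangentSpace (𝓡 n) x) x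
  let b := (EuclideanSpace.basisFun (Fin n) ℝ).toBasis
  let s := e.localFrame b
  have hx : x ∈ e.baseSet := mem_baseSet_trivializationAt _ _ x
  have hs (i : Fin n) := contMDiffAt_localFrame_of_mem (I := 𝓡 n) ∞ e b i hx
  let Γ : M → Matrix (Fin n) (Fin n) ℝ := fun y => Matrix.of fun i j => ⟪s i y, s j y⟫
  have hΓ : ContinuousAt Γ x :=
    continuousAt_pi.2 fun i => continuousAt_pi.2 fun j =>
      (ContMDiffAt.inner_bundle (hs i) (hs j)).continuousAt
  let a : M → Fin n → ℝ := fun y i => diff n φ y (s i y)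
  let c : M → Fin n → ℝ := fun y i => diff n ψ y (s i y)
  have ha : ContinuousAt a x := continuousAt_pi.2 fun i => continuous_diff_section hφ (hs i)
  have hc : ContinuousAt c x := continuousAt_pi.2 fun i => continuous_diff_section hψ (hs i)
  have hdet : ∀ y ∈ e.baseSet, (Γ y).det ≠ 0 := by
    intro y hy h0
    obtain ⟨t, ht, h⟩ := Matrix.exists_mulVec_eq_zero_iff.2 h0
    have hsb : ∀ i, s i y = e.basisAt b hy i := fun i => e.localFrame_apply_of_mem_baseSet b hy
    have h1 : ⟪∑ i, t i • s i y, ∑ j, t j • s j y⟫ = t ⬝ᵥ (Γ y *ᵥ t) := by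
      simp only [sum_inner, inner_sum, real_inner_smul_left, real_inner_smul_right, dotProduct,
        Matrix.mulVec, Γ, Matrix.of_apply, Finset.mul_sum]
      exact Finset.sum_congr rfl fun i _ => Finset.sum_congr rfl fun j _ => by
        rw [real_inner_comm (s j y)]; ring
    rw [h, dotProduct_zero, inner_self_eq_zero] at h1
    simp only [hsb] at h1
    exact ht (funext (Fintype.linearIndependent_iff.1 (e.basisAt b hy).linearIndependent t h1))
  have key : ∀ y ∈ e.baseSet, ⟪grad n φ y, grad n ψ y⟫ =
      a y ⬝ᵥ (((Γ y).det)⁻¹ • ((Γ y).adjugate *ᵥ c y)) := by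
    intro y hy
    have hsb : ∀ i, s i y = e.basisAt b hy i := fun i => e.localFrame_apply_of_mem_baseSet b hy
    let t : Fin n → ℝ := (e.basisAt b hy).repr (grad n ψ y)
    have ht : grad n ψ y = ∑ i, t i • s i y := by
      simp only [hsb, t, (e.basisAt b hy).sum_repr]
    have hct : c y = Γ y *ᵥ t := by
      funext i
      have : c y i = ⟪grad n ψ y, s i y⟫ := by simp [c, grad]
      rw [this, ht]
      simp only [sum_inner, real_inner_smul_left, Matrix.mulVec, dotProduct, Γ, Matrix.of_apply]
      exact Finset.sum_congr rfl fun j _ => by rw [real_inner_comm, mul_comm]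
    have : ((Γ y).det)⁻¹ • ((Γ y).adjugate *ᵥ c y) = t := by
      rw [hct, Matrix.mulVec_mulVec, Matrix.adjugate_mul, Matrix.smul_mulVec, Matrix.one_mulVec,
        smul_smul, inv_mul_cancel₀ (hdet y hy), one_smul]
    rw [this, inner_grad_grad, ht]
    simp [a, dotProduct, mul_comm]
  have hcont := continuousAt_cramer hΓ ha hc (hdet x hx)
  exact hcont.congr (Filter.eventually_of_mem (e.open_baseSet.mem_nhds hx)
    fun y hy => (key y hy).symm)

theorem diff_add {φ ψ : M → ℝ} (hφ : ContMDiff (𝓡 n) 𝓘(ℝ, ℝ) ∞ φ)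
    (hψ : ContMDiff (𝓡 n) 𝓘(ℝ, ℝ) ∞ ψ) (x : M) :
    diff n (φ + ψ) x = diff n φ x + diff n ψ x :=
  mfderiv_add ((hφ x).mdifferentiableAt (by simp)) ((hψ x).mdifferentiableAt (by simp))

theorem diff_smul {φ : M → ℝ} (c : ℝ) (hφ : ContMDiff (𝓡 n) 𝓘(ℝ, ℝ) ∞ φ) (x : M) :
    diff n (c • φ) x = c • diff n φ x :=
  const_smul_mfderiv ((hφ x).mdifferentiableAt (by simp)) c

theorem grad_add {φ ψ : M → ℝ} (hφ : ContMDiff (𝓡 n) 𝓘(ℝ, ℝ) ∞ φ)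
    (hψ : ContMDiff (𝓡 n) 𝓘(ℝ, ℝ) ∞ ψ) (x : M) :
    grad n (φ + ψ) x = grad n φ x + grad n ψ x := by
  simp only [grad, diff_add hφ hψ, map_add]

theorem grad_smul {φ : M → ℝ} (c : ℝ) (hφ : ContMDiff (𝓡 n) 𝓘(ℝ, ℝ) ∞ φ) (x : M) :
    grad n (c • φ) x = c • grad n φ x := by
  simp [grad, diff_smul c hφ]

end Geometry

section Sobolev

variable (n : ℕ) (M : Type*) [TopologicalSpace M] [ChartedSpace (EuclideanSpace ℝ (Fin n)) M]
  [IsManifold (𝓡 n) ∞ M] [RiemannianBundle (fun x : M => TangentSpace (𝓡 n) x)]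
  [IsContMDiffRiemannianBundle (𝓡 n) ∞ (EuclideanSpace ℝ (Fin n))
    (fun x : M => TangentSpace (𝓡 n) x)]
  [MeasurableSpace M] [BorelSpace M]

variable {n M} in
theorem continuous_norm_grad {φ : M → ℝ} (hφ : ContMDiff (𝓡 n) 𝓘(ℝ, ℝ) ∞ φ) :
    Continuous fun x => ‖grad n φ x‖ := by
  simp only [norm_eq_sqrt_real_inner]
  exact (continuous_inner_grad hφ hφ).sqrt

variable {n M} in
theorem integrable_inner_grad {μ : Measure M} {φ ψ : M → ℝ}
    (hφ : ContMDiff (𝓡 n) 𝓘(ℝ, ℝ) ∞ φ) (hψ : ContMDiff (𝓡 n) 𝓘(ℝ, ℝ) ∞ ψ)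
    (h1 : MemLp (fun x => ‖grad n φ x‖) 2 μ) (h2 : MemLp (fun x => ‖grad n ψ x‖) 2 μ) :
    Integrable (fun x => ⟪grad n φ x, grad n ψ x⟫) μ := by
  refine (h1.integrable_mul h2).mono (continuous_inner_grad hφ hψ).aestronglyMeasurable
    (Filter.Eventually.of_forall fun x => ?_)
  simpa using abs_real_inner_le_norm (grad n φ x) (grad n ψ x)

/-- The smooth functions `φ` on `M` with `φ` and `|dφ|` in `L²` (on a closed manifold: all smooth
functions). -/
def smoothSubmodule : Submodule ℝ C^∞⟮𝓡 n, M; 𝓘(ℝ, ℝ), ℝ⟯ where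
  carrier := {φ | MemLp φ 2 (riemannianVolume n M) ∧
    MemLp (fun x => ‖grad n φ x‖) 2 (riemannianVolume n M)}
  zero_mem' := by
    refine ⟨MemLp.zero, ?_⟩
    have : ∀ x : M, ‖grad n (0 : M → ℝ) x‖ = 0 := fun x => by
      have := grad_smul (n := n) (φ := (0 : M → ℝ)) 0 contMDiff_const x
      simp only [zero_smul] at this
      simp [this]
    simp [ContMDiffMap.coe_zero, this]
  add_mem' := by
    rintro φ ψ ⟨h1, h2⟩ ⟨h3, h4⟩
    refine ⟨h1.add h3, (h2.add h4).mono (continuous_norm_grad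
      (φ + ψ).contMDiff).aestronglyMeasurable (Filter.Eventually.of_forall fun x => ?_)⟩
    rw [ContMDiffMap.coe_add, grad_add φ.contMDiff ψ.contMDiff, norm_norm]
    exact (norm_add_le _ _).trans (le_abs_self _)
  smul_mem' := by
    rintro c φ ⟨h1, h2⟩
    refine ⟨h1.const_smul c, ?_⟩
    simp only [ContMDiffMap.coe_smul, grad_smul c φ.contMDiff, norm_smul]
    exact h2.const_mul _

/-- The space `C^∞(M)`, to be equipped with the `H¹` norm. -/
def SmoothH1 : Type _ := smoothSubmodule n M

namespace SmoothH1

instance : AddCommGroup (SmoothH1 n M) := inferInstanceAs (AddCommGroup (smoothSubmodule n M))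
instance : Module ℝ (SmoothH1 n M) := inferInstanceAs (Module ℝ (smoothSubmodule n M))

variable {n M}

/-- The underlying function. -/
def toFun (φ : SmoothH1 n M) : M → ℝ := φ.1

theorem contMDiff (φ : SmoothH1 n M) : ContMDiff (𝓡 n) 𝓘(ℝ, ℝ) ∞ φ.toFun := φ.1.contMDiff
theorem memLp (φ : SmoothH1 n M) : MemLp φ.toFun 2 (riemannianVolume n M) := φ.2.1
theorem memLp_grad (φ : SmoothH1 n M) :
    MemLp (fun x => ‖grad n φ.toFun x‖) 2 (riemannianVolume n M) := φ.2.2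
theorem toFun_add (φ ψ : SmoothH1 n M) : (φ + ψ).toFun = φ.toFun + ψ.toFun := rfl
theorem toFun_smul (c : ℝ) (φ : SmoothH1 n M) : (c • φ).toFun = c • φ.toFun := rfl

/-- The `H¹` inner product `∫ φ ψ + ∫ ⟨dφ, dψ⟩` on smooth functions. -/
instance core : PreInnerProductSpace.Core ℝ (SmoothH1 n M) where
  inner φ ψ := ∫ x, φ.toFun x * ψ.toFun x ∂riemannianVolume n M
    + ∫ x, ⟪grad n φ.toFun x, grad n ψ.toFun x⟫ ∂riemannianVolume n M
  conj_inner_symm φ ψ := by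
    simp only [conj_trivial, real_inner_comm, mul_comm]
  re_inner_nonneg φ :=
    add_nonneg (integral_nonneg fun x => mul_self_nonneg _)
      (integral_nonneg fun x => real_inner_self_nonneg)
  add_left φ ψ χ := by
    simp only [toFun_add, grad_add φ.contMDiff ψ.contMDiff, inner_add_left, Pi.add_apply, add_mul]
    have h1 : Integrable (fun x => φ.toFun x * χ.toFun x) (riemannianVolume n M) :=
      φ.memLp.integrable_mul χ.memLp
    have h2 : Integrable (fun x => ψ.toFun x * χ.toFun x) (riemannianVolume n M) :=
      ψ.memLp.integrable_mul χ.memLp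
    rw [integral_add h1 h2,
      integral_add (integrable_inner_grad φ.contMDiff χ.contMDiff φ.memLp_grad χ.memLp_grad)
        (integrable_inner_grad ψ.contMDiff χ.contMDiff ψ.memLp_grad χ.memLp_grad)]
    ring
  smul_left φ ψ c := by
    simp only [toFun_smul, grad_smul c φ.contMDiff, real_inner_smul_left, Pi.smul_apply,
      smul_eq_mul, mul_assoc, integral_const_mul, conj_trivial]
    ring

instance : SeminormedAddCommGroup (SmoothH1 n M) :=
  InnerProductSpace.Core.toSeminormedAddCommGroup (𝕜 := ℝ)

instance : InnerProductSpace ℝ (SmoothH1 n M) := InnerProductSpace.ofCore core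

theorem inner_def (φ ψ : SmoothH1 n M) :
    ⟪φ, ψ⟫ = ∫ x, φ.toFun x * ψ.toFun x ∂riemannianVolume n M
      + ∫ x, ⟪grad n φ.toFun x, grad n ψ.toFun x⟫ ∂riemannianVolume n M := rfl

theorem norm_toLp_sq (φ : SmoothH1 n M) :
    ‖φ.memLp.toLp φ.toFun‖ ^ 2 = ∫ x, φ.toFun x * φ.toFun x ∂riemannianVolume n M := by
  rw [← real_inner_self_eq_norm_sq, L2.inner_def]
  refine integral_congr_ae ?_
  filter_upwards [φ.memLp.coeFn_toLp] with x hx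
  simp [hx, pow_two]

theorem norm_toLp_le (φ : SmoothH1 n M) : ‖φ.memLp.toLp φ.toFun‖ ≤ 1 * ‖φ‖ := by
  have h2 : ‖φ‖ ^ 2 = _ := (real_inner_self_eq_norm_sq φ).symm.trans (inner_def φ φ)
  have h3 : 0 ≤ ∫ x, ⟪grad n φ.toFun x, grad n φ.toFun x⟫ ∂riemannianVolume n M :=
    integral_nonneg fun x => real_inner_self_nonneg
  rw [one_mul]
  refine le_of_sq_le_sq ?_ (norm_nonneg _)
  rw [norm_toLp_sq, h2]
  linarith

/-- The class in `L²(M)` of a smooth function. -/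
def toL2 : SmoothH1 n M →L[ℝ] Lp ℝ 2 (riemannianVolume n M) :=
  LinearMap.mkContinuous
    { toFun := fun φ => φ.memLp.toLp φ.toFun
      map_add' := fun φ ψ => MemLp.toLp_add φ.memLp ψ.memLp
      map_smul' := fun c φ => MemLp.toLp_const_smul c φ.memLp } 1 norm_toLp_le

end SmoothH1

/-- The Sobolev space `H¹(M)`: the completion of `C^∞(M)` for the `H¹` norm. -/
abbrev H1 : Type _ := UniformSpace.Completion (SmoothH1 n M)

variable {n M}

/-- The function in `L²(M)` given by an element of `H¹(M)`. -/
def toL2 : H1 n M →L[ℝ] Lp ℝ 2 (riemannianVolume n M) := SmoothH1.toL2.fromCompletion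

/-- The Dirichlet form `∫ ⟨du, dv⟩` on `H¹(M)`: the `H¹` inner product without its `L²` part. -/
def dirichletForm (u v : H1 n M) : ℝ := ⟪u, v⟫ - ⟪toL2 u, toL2 v⟫

theorem dirichletForm_coe (φ ψ : SmoothH1 n M) :
    dirichletForm (φ : H1 n M) (ψ : H1 n M) =
      ∫ x, ⟪grad n φ.toFun x, grad n ψ.toFun x⟫ ∂riemannianVolume n M := by
  have h : ⟪φ.memLp.toLp φ.toFun, ψ.memLp.toLp ψ.toFun⟫ =
      ∫ x, φ.toFun x * ψ.toFun x ∂riemannianVolume n M := by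
    rw [L2.inner_def]
    refine integral_congr_ae ?_
    filter_upwards [φ.memLp.coeFn_toLp, ψ.memLp.coeFn_toLp] with x hx hy
    simp [hx, hy, mul_comm]
  have h1 : toL2 (φ : H1 n M) = φ.memLp.toLp φ.toFun :=
    ContinuousLinearMap.fromCompletion_apply_coe _ _
  have h2 : toL2 (ψ : H1 n M) = ψ.memLp.toLp ψ.toFun :=
    ContinuousLinearMap.fromCompletion_apply_coe _ _
  rw [dirichletForm, h1, h2, h, UniformSpace.Completion.inner_coe, SmoothH1.inner_def]
  ring

/-- The symmetric form `∫ ⟨du, dv⟩ + ∫ V u v` of the Schrödinger operator `-Δ + V`. -/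
def schrodingerForm (V : M → ℝ) (u v : H1 n M) : ℝ :=
  dirichletForm u v + ∫ x, V x * toL2 u x * toL2 v x ∂riemannianVolume n M

/-- The quadratic form `Q(u) = ∫ |du|² + ∫ V u²`. -/
def Q (V : M → ℝ) (u : H1 n M) : ℝ := schrodingerForm V u u

/-- `u ∈ H¹(M)` is an eigenfunction of `-Δ + V` with eigenvalue `l`: `u ≠ 0` and
`-Δu + Vu = l u` holds weakly. -/
def IsEigenfunction (V : M → ℝ) (l : ℝ) (u : H1 n M) : Prop :=
  u ≠ 0 ∧ ∀ v : H1 n M, schrodingerForm V u v = l * ⟪toL2 u, toL2 v⟫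

variable (n) in
/-- The first (that is, the smallest) eigenvalue `λ₁(M)` of `-Δ + V`. -/
def firstEigenvalue (V : M → ℝ) : ℝ := sInf {l : ℝ | ∃ u : H1 n M, IsEigenfunction V l u}

variable (n) in
/-- `H₀¹(M - A)`: the closure in `H¹(M)` of the functions that vanish almost everywhere on an open
neighborhood of `A`. -/
def H10 (A : Set M) : Set (H1 n M) :=
  closure {g | ∃ U : Set M, IsOpen U ∧ A ⊆ U ∧
    ∀ᵐ x ∂riemannianVolume n M, x ∈ U → toL2 g x = 0}

/-- The set `S_A(M)` of all `u ∈ H¹(M)` with `∫ u = 0` and `u - e₁ ∈ H₀¹(M - A)`. -/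
def admissible (e₁ : H1 n M) (A : Set M) : Set (H1 n M) :=
  {u | ∫ x, toL2 u x ∂riemannianVolume n M = 0 ∧ u - e₁ ∈ H10 n A}

/-- The Schrödinger capacity `cap(A) = inf {Q(u) | u ∈ S_A(M)}`, which is `+∞` if `S_A(M) = ∅`. -/
def cap (V : M → ℝ) (e₁ : H1 n M) (A : Set M) : EReal :=
  ⨅ u ∈ admissible e₁ A, (Q V u : EReal)

/-- `u` is a capacity minimizer `u_A` of `A`. -/
def IsCapMinimizer (V : M → ℝ) (e₁ : H1 n M) (A : Set M) (u : H1 n M) : Prop :=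
  u ∈ admissible e₁ A ∧ (Q V u : EReal) = cap V e₁ A

end Sobolev

end Schrodinger

end

/-!
The capacity minimizer of `A` is the point of least energy in the set `S_A(M)`. As the potential
is bounded below by a positive constant, the Schrödinger form is coercive on `H¹(M)`
(`schrodingerForm_coercive`), so its quadratic form `Q` attains its infimum over every nonempty
closed convex set, and at one point only (`exists_isMinOn_of_coercive`,
`eq_of_isMinOn_of_coercive`). The set `S_A(M)` is convex and closed; closedness needs the mean to
be continuous on `L²(M)`, hence the volume of `M` to be finite. The volume is a supremum of
measures given in charts. The change of variables formula shows that these agree on overlaps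
(`chartMeasure_eq_of_subset`), so the volume restricts to each of them
(`riemannianVolume_restrict_source`) and is finite by compactness.

The bound on the `L²` norm is the inequality `λ₁ ‖u‖² ≤ Q u`, which holds for all `u` in `H¹(M)`
(`firstEigenvalue_mul_norm_sq_le`). Since `λ₁` is the infimum of the eigenvalues, it must be shown
that the infimum of the Rayleigh quotient is an eigenvalue, that is, that it is attained. This
holds for every coercive form relative to a compact operator (`exists_eigenvector_of_coercive`),
and the compactness of `H¹(M) → L²(M)` is Rellich's theorem (`totallyBounded_image_toL2`).

Rellich's theorem is proved without cutoff functions. Finitely many closed coordinate balls cover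
`M`; each is cut by a fine grid into convex pieces, and on a convex piece of diameter `d` the
Poincaré inequality (`lintegral_enorm_sub_sq_le`) bounds the `L²` norm by `C d²` times the Dirichlet
integral, up to the square of the mean over the piece. Hence the `L²` norm is bounded by an
arbitrarily small multiple of the `H¹` norm up to finitely many functionals
(`exists_finiteRank_estimate`).
-/

noncomputable section

namespace Schrodinger

universe u

/-! ### Coercive forms on Banach spaces -/

section Abstract

open Filter Topology

variable {H : Type*} [NormedAddCommGroup H] [NormedSpace ℝ H]

/-- A positive semidefinite symmetric form vanishes against each of its isotropic vectors. -/
theorem form_eq_zero_of_isotropic {φ : H → H → ℝ}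
    (hquad : ∀ (u v : H) (t : ℝ), φ (u + t • v) (u + t • v) =
      φ u u + 2 * t * φ u v + t ^ 2 * φ v v)
    (hnonneg : ∀ u, 0 ≤ φ u u) {u : H} (hu : φ u u = 0) (v : H) : φ u v = 0 := by
  have h (t : ℝ) : 0 ≤ φ v v * (t * t) + 2 * φ u v * t + 0 := by
    have := hnonneg (u + t • v)
    rw [hquad, hu] at this
    linarith
  have := discrim_le_zero h
  rw [discrim] at this
  nlinarith [sq_nonneg (φ u v)]

variable (B : H →L[ℝ] H →L[ℝ] ℝ)

theorem quadratic_add_smul (hsymm : ∀ u v, B u v = B v u) (u v : H) (t : ℝ) :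
    B (u + t • v) (u + t • v) = B u u + 2 * t * B u v + t ^ 2 * B v v := by
  simp only [map_add, map_smul, add_apply, smul_apply,
    smul_eq_mul, hsymm v u]
  ring

theorem quadratic_smul (t : ℝ) (u : H) : B (t • u) (t • u) = t ^ 2 * B u u := by
  simp only [map_smul, smul_apply, smul_eq_mul]
  ring

theorem parallelogram (u v : H) :
    B (u - v) (u - v) = 2 * B u u + 2 * B v v - 4 * B (midpoint ℝ u v) (midpoint ℝ u v) := by
  have h : midpoint ℝ u v = (2⁻¹ : ℝ) • (u + v) := by rw [midpoint_eq_smul_add]; simp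
  rw [h, quadratic_smul]
  simp only [map_add, map_sub, add_apply, sub_apply]
  ring

variable {B} {c : ℝ}

/-- A coercive quadratic form attains its infimum over a nonempty closed convex set: by the
parallelogram identity minimizing sequences are Cauchy. -/
theorem exists_isMinOn_of_coercive [CompleteSpace H] (hc : 0 < c)
    (hcoer : ∀ u, c * ‖u‖ ^ 2 ≤ B u u) {K : Set H} (hK : IsClosed K) (hconv : Convex ℝ K)
    (hne : K.Nonempty) : ∃ u ∈ K, ∀ v ∈ K, B u u ≤ B v v := by
  set q : H → ℝ := fun u => B u u with hq
  have hqc : Continuous q := by fun_prop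
  have hbdd : BddBelow (q '' K) :=
    ⟨0, by rintro _ ⟨u, -, rfl⟩; exact (by positivity : 0 ≤ c * ‖u‖ ^ 2).trans (hcoer u)⟩
  set m := sInf (q '' K) with hm
  have hle (v) (hv : v ∈ K) : m ≤ q v := csInf_le hbdd ⟨v, hv, rfl⟩
  obtain ⟨s, -, hs, hsK⟩ := exists_seq_tendsto_sInf (hne.image q) hbdd
  choose u huK hu using hsK
  have hlim : Tendsto (fun k => q (u k)) atTop (𝓝 m) := by simpa only [hu] using hs
  have hdist (k l : ℕ) : c * ‖u k - u l‖ ^ 2 ≤ 2 * (q (u k) - m) + 2 * (q (u l) - m) := by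
    have h1 := hcoer (u k - u l)
    have h2 := hle _ (hconv.midpoint_mem (huK k) (huK l))
    rw [parallelogram] at h1
    simp only [hq] at h2 ⊢
    linarith
  have hcau : CauchySeq u := by
    rw [Metric.cauchySeq_iff]
    intro ε hε
    obtain ⟨N, hN⟩ := eventually_atTop.1
      (hlim.eventually (gt_mem_nhds (show m < m + c * ε ^ 2 / 4 by
        have : 0 < c * ε ^ 2 / 4 := by positivity
        linarith)))
    refine ⟨N, fun k hk l hl => ?_⟩
    rw [dist_eq_norm]
    have h1 := hN k hk
    have h2 := hN l hl
    have h3 : c * ‖u k - u l‖ ^ 2 < c * ε ^ 2 := by linarith [hdist k l]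
    exact lt_of_pow_lt_pow_left₀ 2 hε.le (lt_of_mul_lt_mul_left h3 hc.le)
  obtain ⟨w, hw⟩ := cauchySeq_tendsto_of_complete hcau
  have hqw : q w = m := tendsto_nhds_unique ((hqc.tendsto w).comp hw) hlim
  exact ⟨w, hK.mem_of_tendsto hw (Eventually.of_forall huK), fun v hv => hqw.trans_le (hle v hv)⟩

theorem eq_of_isMinOn_of_coercive (hc : 0 < c) (hcoer : ∀ u, c * ‖u‖ ^ 2 ≤ B u u) {K : Set H}
    (hconv : Convex ℝ K) {u v : H} (hu : u ∈ K) (hv : v ∈ K) (humin : ∀ w ∈ K, B u u ≤ B w w)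
    (hvmin : ∀ w ∈ K, B v v ≤ B w w) : u = v := by
  have h1 := hcoer (u - v)
  have h2 := humin _ (hconv.midpoint_mem hu hv)
  have h3 := hvmin _ (hconv.midpoint_mem hu hv)
  rw [parallelogram] at h1
  have h4 : c * ‖u - v‖ ^ 2 ≤ 0 := by linarith
  have h5 : ‖u - v‖ ^ 2 ≤ 0 := nonpos_of_mul_nonpos_right h4 hc
  exact sub_eq_zero.1 (norm_eq_zero.1 (pow_eq_zero_iff two_ne_zero |>.1
    (le_antisymm h5 (sq_nonneg _))))

/-- An operator that is small in norm up to finitely many linear functionals is compact. -/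
theorem totallyBounded_image_of_finiteRank_estimate {L : Type*} [NormedAddCommGroup L]
    [NormedSpace ℝ L] (T : H →L[ℝ] L)
    (hT : ∀ ε > 0, ∃ (ι : Type*) (_ : Fintype ι) (ℓ : ι → H →L[ℝ] ℝ),
      ∀ u, ‖T u‖ ^ 2 ≤ ε * ‖u‖ ^ 2 + ∑ i, ℓ i u ^ 2)
    {D : Set H} (hD : Bornology.IsBounded D) : TotallyBounded (T '' D) := by
  obtain ⟨R, hR, hDR⟩ := hD.subset_closedBall_lt 0 0
  rw [Metric.totallyBounded_iff]
  intro ε hε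
  obtain ⟨ι, _, ℓ, hℓ⟩ := hT (ε ^ 2 / (8 * R ^ 2)) (by positivity)
  let S : H →L[ℝ] (ι → ℝ) := ContinuousLinearMap.pi ℓ
  have hb : TotallyBounded (S '' D) :=
    ((hD.image S).isCompact_closure).totallyBounded.subset subset_closure
  set η : ℝ := ε / (2 * (Fintype.card ι + 1)) with hη
  have hη0 : 0 < η := by positivity
  obtain ⟨t, htD, htfin, ht⟩ := Metric.finite_approx_of_totallyBounded hb η hη0
  choose! g hgD hgS using fun y (hy : y ∈ t) => htD hy
  refine ⟨(T ∘ g) '' t, htfin.image _, ?_⟩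
  rintro _ ⟨u, hu, rfl⟩
  obtain ⟨y, hyt, hy⟩ := Set.mem_iUnion₂.1 (ht ⟨u, hu, rfl⟩)
  refine Set.mem_iUnion₂.2 ⟨T (g y), ⟨y, hyt, rfl⟩, ?_⟩
  have h1 := mem_closedBall_zero_iff.1 (hDR hu)
  have h2 := mem_closedBall_zero_iff.1 (hDR (hgD y hyt))
  rw [Metric.mem_ball, ← hgS y hyt, dist_eq_norm, ← map_sub] at hy
  rw [Metric.mem_ball, dist_eq_norm, ← map_sub]
  have h3 : ‖u - g y‖ ≤ R + R := (norm_sub_le _ _).trans (add_le_add h1 h2)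
  have h4 (i : ι) : ℓ i (u - g y) ^ 2 ≤ η ^ 2 := by
    rw [← sq_abs]
    gcongr
    exact (norm_le_pi_norm (S (u - g y)) i).trans hy.le
  have h5 : (Fintype.card ι : ℝ) * η ^ 2 ≤ ε ^ 2 / 4 := by
    have : (Fintype.card ι : ℝ) / (Fintype.card ι + 1) ^ 2 ≤ 1 := by
      rw [div_le_one (by positivity)]
      nlinarith [(Nat.cast_nonneg (Fintype.card ι) : (0 : ℝ) ≤ _)]
    calc (Fintype.card ι : ℝ) * η ^ 2
        = (Fintype.card ι : ℝ) / (Fintype.card ι + 1) ^ 2 * (ε ^ 2 / 4) := by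
          rw [hη]; field_simp; ring
      _ ≤ 1 * (ε ^ 2 / 4) := by gcongr
      _ = _ := one_mul _
  refine lt_of_pow_lt_pow_left₀ 2 hε.le ?_
  calc ‖T (u - g y)‖ ^ 2 ≤ ε ^ 2 / (8 * R ^ 2) * ‖u - g y‖ ^ 2 + ∑ i, ℓ i (u - g y) ^ 2 := hℓ _
    _ ≤ ε ^ 2 / (8 * R ^ 2) * (R + R) ^ 2 + ∑ _i : ι, η ^ 2 := by
        exact add_le_add (by gcongr) (Finset.sum_le_sum fun i _ => h4 i)
    _ = ε ^ 2 / 2 + Fintype.card ι * η ^ 2 := by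
        rw [Finset.sum_const, Finset.card_univ, nsmul_eq_mul]
        field_simp
        ring
    _ < ε ^ 2 := by nlinarith [sq_pos_of_pos hε]

/-- The first eigenvalue of a coercive form relative to a compact operator `T` exists and is the
minimum of the Rayleigh quotient `B u u / ‖T u‖²`. The point `f` of largest norm in the closure of
the image of the unit ball of `B` need not be a value of `T`; it is replaced by the value at the
minimizer of `B` on the half space `⟪T u, f⟫ ≥ ‖f‖²`. -/
theorem exists_eigenvector_of_coercive [CompleteSpace H] {L : Type*} [NormedAddCommGroup L]
    [InnerProductSpace ℝ L] [CompleteSpace L] (T : H →L[ℝ] L)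
    (hT : ∀ D : Set H, Bornology.IsBounded D → TotallyBounded (T '' D)) (hT0 : T ≠ 0)
    (hc : 0 < c) (hsymm : ∀ u v, B u v = B v u) (hcoer : ∀ u, c * ‖u‖ ^ 2 ≤ B u u) :
    ∃ (l : ℝ) (u : H), u ≠ 0 ∧ (∀ v, B u v = l * ⟪T u, T v⟫) ∧ ∀ v, l * ‖T v‖ ^ 2 ≤ B v v := by
  have hnn (u : H) : 0 ≤ B u u := (by positivity : 0 ≤ c * ‖u‖ ^ 2).trans (hcoer u)
  have hpos (u : H) (hu : u ≠ 0) : 0 < B u u :=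
    (by have := norm_pos_iff.2 hu; positivity : 0 < c * ‖u‖ ^ 2).trans_le (hcoer u)
  set D : Set H := {u | B u u ≤ 1} with hDdef
  have hD : Bornology.IsBounded D := by
    refine (Metric.isBounded_closedBall (x := (0 : H)) (r := 1 + c⁻¹)).subset fun u hu => ?_
    rw [mem_closedBall_zero_iff]
    have h1 : ‖u‖ ^ 2 ≤ c⁻¹ := by
      rw [← one_div, le_div_iff₀ hc, mul_comm]
      exact (hcoer u).trans hu
    nlinarith [norm_nonneg u]
  have hcomp : IsCompact (closure (T '' D)) :=
    (hT D hD).closure.isCompact_of_isClosed isClosed_closure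
  have hne : (closure (T '' D)).Nonempty :=
    ⟨T 0, subset_closure ⟨0, by simp [hDdef], rfl⟩⟩
  obtain ⟨f, hf, hfmax⟩ := hcomp.exists_isMaxOn hne continuous_norm.continuousOn
  have hmax (v : H) : ‖T v‖ ^ 2 ≤ ‖f‖ ^ 2 * B v v := by
    rcases eq_or_ne v 0 with rfl | hv
    · simp
    have hb := hpos v hv
    have hs : 0 < √(B v v) := Real.sqrt_pos.2 hb
    have hmem : (√(B v v))⁻¹ • v ∈ D := by
      simp only [hDdef, Set.mem_ofPred_eq, quadratic_smul, inv_pow, Real.sq_sqrt hb.le]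
      exact (inv_mul_cancel₀ hb.ne').le
    have h1 : ‖T ((√(B v v))⁻¹ • v)‖ ≤ ‖f‖ := hfmax (subset_closure ⟨_, hmem, rfl⟩)
    rw [map_smul, norm_smul, norm_inv, Real.norm_of_nonneg hs.le, inv_mul_le_iff₀ hs] at h1
    calc ‖T v‖ ^ 2 ≤ (√(B v v) * ‖f‖) ^ 2 := by gcongr
      _ = ‖f‖ ^ 2 * B v v := by rw [mul_pow, Real.sq_sqrt hb.le, mul_comm]
  have hf0 : 0 < ‖f‖ := by
    by_contra h
    have hf0 : ‖f‖ = 0 := le_antisymm (not_lt.1 h) (norm_nonneg f)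
    refine hT0 (ContinuousLinearMap.ext fun v => ?_)
    have := hmax v
    rw [hf0] at this
    simp only [ne_eq, OfNat.ofNat_ne_zero, not_false_eq_true, zero_pow, zero_mul] at this
    exact norm_eq_zero.1 (pow_eq_zero_iff two_ne_zero |>.1 (le_antisymm this (sq_nonneg _)))
  -- The half space of vectors whose image is at least as long in the direction of `f` as `f`.
  set K : Set H := {u | ‖f‖ ^ 2 ≤ ⟪f, T u⟫} with hKdef
  have hKclosed : IsClosed K := isClosed_le continuous_const (by fun_prop)
  have hKconv : Convex ℝ K := by
    have : K = ((innerSL ℝ f).comp T : H →L[ℝ] ℝ) ⁻¹' Set.Ici (‖f‖ ^ 2) := rfl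
    rw [this]
    exact (convex_Ici _).is_linear_preimage ((innerSL ℝ f).comp T).toLinearMap.isLinear
  have hscale (v : H) (hv : ⟪f, T v⟫ ≠ 0) : (‖f‖ ^ 2 / ⟪f, T v⟫) • v ∈ K := by
    simp only [hKdef, Set.mem_ofPred_eq, map_smul, real_inner_smul_right]
    rw [div_mul_cancel₀ _ hv]
  have hex : ∃ v, ⟪f, T v⟫ ≠ 0 := by
    by_contra! h
    have : f ∈ {g : L | ⟪f, g⟫ = 0} := by
      refine closure_minimal ?_ (isClosed_eq (by fun_prop) continuous_const) hf
      rintro _ ⟨v, -, rfl⟩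
      exact h v
    rw [Set.mem_ofPred_eq, real_inner_self_eq_norm_sq] at this
    nlinarith
  obtain ⟨v₀, hv₀⟩ := hex
  obtain ⟨u, huK, hu⟩ := exists_isMinOn_of_coercive hc hcoer hKclosed hKconv ⟨_, hscale v₀ hv₀⟩
  -- Every `v` in the unit ball can be scaled into `K`, which bounds `B u u` in terms of `⟪f, T v⟫`;
  -- the bound is preserved under limits, and `f` is a limit of such values `T v`.
  have hu1 : B u u ≤ 1 := by
    have : f ∈ {g : L | ⟪f, g⟫ ^ 2 * B u u ≤ (‖f‖ ^ 2) ^ 2} := by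
      refine closure_minimal ?_ (isClosed_le (by fun_prop) continuous_const) hf
      rintro _ ⟨v, hvD, rfl⟩
      rcases eq_or_ne ⟪f, T v⟫ 0 with h0 | h0
      · simp only [Set.mem_ofPred_eq, h0, ne_eq, OfNat.ofNat_ne_zero, not_false_eq_true, zero_pow,
          zero_mul]
        positivity
      have h1 := hu _ (hscale v h0)
      rw [quadratic_smul, div_pow] at h1
      have h2 : 0 < ⟪f, T v⟫ ^ 2 := by positivity
      have hvD' : B v v ≤ 1 := hvD
      calc ⟪f, T v⟫ ^ 2 * B u u
          ≤ ⟪f, T v⟫ ^ 2 * ((‖f‖ ^ 2) ^ 2 / ⟪f, T v⟫ ^ 2 * B v v) := by gcongr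
        _ = (‖f‖ ^ 2) ^ 2 * B v v := by field_simp
        _ ≤ (‖f‖ ^ 2) ^ 2 * 1 := by gcongr
        _ = _ := mul_one _
    rw [Set.mem_ofPred_eq, real_inner_self_eq_norm_sq] at this
    exact le_of_mul_le_mul_left (this.trans_eq (mul_one _).symm) (by positivity)
  have huT : ‖f‖ ≤ ‖T u‖ := by
    have h1 : ‖f‖ ^ 2 ≤ ‖f‖ * ‖T u‖ := (show ‖f‖ ^ 2 ≤ ⟪f, T u⟫ from huK).trans
      (real_inner_le_norm _ _)
    rw [pow_two] at h1
    exact le_of_mul_le_mul_left h1 hf0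
  have hiso : ‖f‖ ^ 2 * B u u - ⟪T u, T u⟫ = 0 := by
    rw [real_inner_self_eq_norm_sq]
    have h1 := hmax u
    have h2 : ‖f‖ ^ 2 ≤ ‖T u‖ ^ 2 := by gcongr
    have h3 : ‖f‖ ^ 2 * B u u ≤ ‖f‖ ^ 2 * 1 := by gcongr
    linarith
  have hzero := form_eq_zero_of_isotropic (φ := fun u v => ‖f‖ ^ 2 * B u v - ⟪T u, T v⟫)
    (fun u v t => by
      simp only [quadratic_add_smul B hsymm]
      simp only [map_add, map_smul, inner_add_left, inner_add_right, real_inner_smul_left,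
        real_inner_smul_right, real_inner_comm (T u) (T v)]
      ring)
    (fun v => by
      simp only [real_inner_self_eq_norm_sq]
      linarith [hmax v]) hiso
  refine ⟨(‖f‖ ^ 2)⁻¹, u, ?_, fun v => ?_, fun v => ?_⟩
  · rintro rfl
    simp only [map_zero, norm_zero] at huT
    linarith
  · rw [eq_inv_mul_iff_mul_eq₀ (by positivity)]
    linarith [hzero v]
  · rw [inv_mul_le_iff₀ (by positivity)]
    exact hmax v

end Abstract

/-! ### The Poincaré inequality on convex sets -/

section Poincare

open Set
open scoped ENNReal

theorem sq_lintegral_le_lintegral_sq {α : Type*} [MeasurableSpace α] {μ : Measure α}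
    (hμ : μ univ = 1) {h : α → ℝ≥0∞} (hh : AEMeasurable h μ) :
    (∫⁻ t, h t ∂μ) ^ 2 ≤ ∫⁻ t, h t ^ 2 ∂μ := by
  have := ENNReal.lintegral_mul_le_Lp_mul_Lq μ Real.HolderConjugate.two_two
    (f := fun _ => 1) aemeasurable_const hh
  simp only [Pi.mul_apply, one_mul, ENNReal.one_rpow, lintegral_one, hμ] at this
  calc (∫⁻ t, h t ∂μ) ^ 2 ≤ ((∫⁻ t, h t ^ (2 : ℝ) ∂μ) ^ (1 / (2 : ℝ))) ^ 2 := by gcongr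
    _ = ∫⁻ t, h t ^ (2 : ℝ) ∂μ := by
      rw [← ENNReal.rpow_natCast, ← ENNReal.rpow_mul]; norm_num
    _ = _ := by simp

variable {E : Type*} [NormedAddCommGroup E] [NormedSpace ℝ E] [FiniteDimensional ℝ E]
  [MeasurableSpace E] [BorelSpace E]

theorem lintegral_comp_add_smul_sub (μ : Measure E) [μ.IsAddHaarMeasure] {G : E → ℝ≥0∞}
    (hG : Measurable G) (y : E) {r : ℝ} (hr : r ≠ 0) :
    ∫⁻ x, G (y + r • (x - y)) ∂μ =
      ENNReal.ofReal |(r ^ Module.finrank ℝ E)⁻¹| * ∫⁻ x, G x ∂μ := by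
  rw [lintegral_sub_right_eq_self (fun x => G (y + r • x)) y,
    ← lintegral_map (f := fun z => G (y + z)) (g := fun x => r • x)
      (hG.comp (measurable_const_add y)) (measurable_const_smul r),
    Measure.map_addHaar_smul μ hr, lintegral_smul_measure, smul_eq_mul,
    lintegral_add_left_eq_self]

/-- A contraction of a convex set towards one of its points, by a factor at least `1/2`, increases
densities at most by the factor `2 ^ dim E`. -/
theorem setLIntegral_contraction_le (μ : Measure E) [μ.IsAddHaarMeasure] {Q : Set E}
    (hQ : Convex ℝ Q) (hQm : MeasurableSet Q) {g : E → ℝ≥0∞} (hg : Measurable g) {y : E}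
    (hy : y ∈ Q) {r : ℝ} (hr : 1 / 2 ≤ r) (hr1 : r ≤ 1) :
    ∫⁻ x in Q, g (y + r • (x - y)) ∂μ ≤
      2 ^ Module.finrank ℝ E * ∫⁻ x in Q, g x ∂μ := by
  have hr0 : 0 < r := by linarith
  calc ∫⁻ x in Q, g (y + r • (x - y)) ∂μ
      = ∫⁻ x in Q, Q.indicator g (y + r • (x - y)) ∂μ := by
        refine setLIntegral_congr_fun hQm fun x hx => ?_
        have : y + r • (x - y) ∈ Q := hQ.add_smul_sub_mem hy hx ⟨hr0.le, hr1⟩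
        simp [this]
    _ ≤ ∫⁻ x, Q.indicator g (y + r • (x - y)) ∂μ := setLIntegral_le_lintegral _ _
    _ = ENNReal.ofReal |(r ^ Module.finrank ℝ E)⁻¹| * ∫⁻ x in Q, g x ∂μ := by
        rw [lintegral_comp_add_smul_sub μ (hg.indicator hQm) y hr0.ne', lintegral_indicator hQm]
    _ ≤ _ := by
        gcongr
        rw [abs_of_pos (by positivity), ← inv_pow]
        refine ENNReal.ofReal_le_of_le_toReal ?_
        rw [ENNReal.toReal_pow, ENNReal.toReal_ofNat]
        gcongr
        rw [inv_le_comm₀ hr0 two_pos]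
        linarith

theorem enorm_sub_sq_le_lintegral_fderiv {U : Set E} (hU : IsOpen U) {f : E → ℝ}
    (hf : ContDiffOn ℝ 1 f U) {x y : E} (hxy : segment ℝ x y ⊆ U) :
    ‖f x - f y‖ₑ ^ 2 ≤
      ‖y - x‖ₑ ^ 2 * ∫⁻ t in Ioc (0 : ℝ) 1, ‖fderiv ℝ f (x + t • (y - x))‖ₑ ^ 2 := by
  have hmem (t : ℝ) (ht : t ∈ Icc (0 : ℝ) 1) : x + t • (y - x) ∈ U := by
    refine hxy ?_
    rw [segment_eq_image']
    exact ⟨t, ht, rfl⟩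
  have hline (t : ℝ) : HasDerivAt (fun t : ℝ => x + t • (y - x)) (y - x) t := by
    simpa using ((hasDerivAt_id t).smul_const (y - x)).const_add x
  have hcont : ContinuousOn (fun t : ℝ => fderiv ℝ f (x + t • (y - x))) (Icc 0 1) :=
    (hf.continuousOn_fderiv_of_isOpen hU le_rfl).comp
      (continuous_iff_continuousAt.2 fun t => (hline t).continuousAt).continuousOn hmem
  have hderiv (t : ℝ) (ht : t ∈ Icc (0 : ℝ) 1) : HasDerivAt (fun t : ℝ => f (x + t • (y - x)))
      (fderiv ℝ f (x + t • (y - x)) (y - x)) t :=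
    (((hf.contDiffAt (hU.mem_nhds (hmem t ht))).differentiableAt
      one_ne_zero).hasFDerivAt).comp_hasDerivAt t (hline t)
  have hftc : ∫ t in (0 : ℝ)..1, fderiv ℝ f (x + t • (y - x)) (y - x) = f y - f x := by
    rw [intervalIntegral.integral_eq_sub_of_hasDerivAt (f := fun t : ℝ => f (x + t • (y - x)))]
    · simp
    · intro t ht
      rw [uIcc_of_le zero_le_one] at ht
      exact hderiv t ht
    · refine ContinuousOn.intervalIntegrable ?_
      rw [uIcc_of_le zero_le_one]
      exact hcont.clm_apply continuousOn_const
  have hmeas : AEMeasurable (fun t : ℝ => ‖fderiv ℝ f (x + t • (y - x))‖ₑ)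
      (volume.restrict (Ioc (0 : ℝ) 1)) :=
    ((hcont.mono Ioc_subset_Icc_self).aestronglyMeasurable measurableSet_Ioc).enorm
  have h1 : ‖f x - f y‖ₑ ≤
      ‖y - x‖ₑ * ∫⁻ t in Ioc (0 : ℝ) 1, ‖fderiv ℝ f (x + t • (y - x))‖ₑ := by
    rw [← lintegral_const_mul'' _ hmeas, enorm_sub_rev, ← hftc,
      intervalIntegral.integral_of_le zero_le_one]
    refine (enorm_integral_le_lintegral_enorm _).trans (lintegral_mono fun t => ?_)
    rw [mul_comm]
    exact ContinuousLinearMap.le_opENorm _ _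
  calc ‖f x - f y‖ₑ ^ 2
      ≤ (‖y - x‖ₑ * ∫⁻ t in Ioc (0 : ℝ) 1, ‖fderiv ℝ f (x + t • (y - x))‖ₑ) ^ 2 := by gcongr
    _ = ‖y - x‖ₑ ^ 2 * (∫⁻ t in Ioc (0 : ℝ) 1, ‖fderiv ℝ f (x + t • (y - x))‖ₑ) ^ 2 :=
        mul_pow _ _ _
    _ ≤ _ := by
        gcongr
        exact sq_lintegral_le_lintegral_sq (by simp) hmeas

/-- The Poincaré inequality on a convex set of diameter at most `d`, in the form that bounds the
mean oscillation. It comes from integrating the derivative along the segment from `x` to `y`; at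
each time one of the two endpoints has weight at least `1/2` in the point of the segment, and the
substitution is made in that endpoint. -/
theorem lintegral_enorm_sub_sq_le (μ : Measure E) [μ.IsAddHaarMeasure] {U : Set E} (hU : IsOpen U)
    {f : E → ℝ} (hf : ContDiffOn ℝ 1 f U) {Q : Set E} (hQ : Convex ℝ Q) (hQm : MeasurableSet Q)
    (hQU : Q ⊆ U) {d : ℝ} (hd : ∀ x ∈ Q, ∀ y ∈ Q, ‖y - x‖ ≤ d) :
    ∫⁻ x in Q, ∫⁻ y in Q, ‖f x - f y‖ₑ ^ 2 ∂μ ∂μ ≤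
      ENNReal.ofReal d ^ 2 * (2 ^ Module.finrank ℝ E * μ Q * ∫⁻ z in Q, ‖fderiv ℝ f z‖ₑ ^ 2 ∂μ) := by
  set g : E → ℝ≥0∞ := fun z => ‖fderiv ℝ f z‖ₑ ^ 2 with hg
  have hgm : Measurable g := (measurable_fderiv ℝ f).enorm.pow_const 2
  have hslice (t : ℝ) (ht : t ∈ Ioc (0 : ℝ) 1) :
      ∫⁻ x in Q, ∫⁻ y in Q, g (x + t • (y - x)) ∂μ ∂μ ≤
        2 ^ Module.finrank ℝ E * μ Q * ∫⁻ z in Q, g z ∂μ := by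
    have hconst : ∫⁻ _ in Q, 2 ^ Module.finrank ℝ E * ∫⁻ z in Q, g z ∂μ ∂μ =
        2 ^ Module.finrank ℝ E * μ Q * ∫⁻ z in Q, g z ∂μ := by
      rw [setLIntegral_const]; ring
    rw [← hconst]
    rcases le_total (1 / 2) t with h | h
    · exact setLIntegral_mono' hQm fun x hx => setLIntegral_contraction_le μ hQ hQm hgm hx h ht.2
    · rw [lintegral_lintegral_swap (by
        have : Measurable fun p : E × E => g (p.1 + t • (p.2 - p.1)) := hgm.comp (by fun_prop)
        exact this.aemeasurable)]
      refine setLIntegral_mono' hQm fun y hy => ?_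
      have (x : E) : x + t • (y - x) = y + (1 - t) • (x - y) := by
        module
      simp only [this]
      exact setLIntegral_contraction_le μ hQ hQm hgm hy (by linarith) (by linarith [ht.1])
  calc ∫⁻ x in Q, ∫⁻ y in Q, ‖f x - f y‖ₑ ^ 2 ∂μ ∂μ
      ≤ ∫⁻ x in Q, ∫⁻ y in Q, ENNReal.ofReal d ^ 2 *
          (∫⁻ t in Ioc (0 : ℝ) 1, g (x + t • (y - x))) ∂μ ∂μ := by
        refine setLIntegral_mono' hQm fun x hx => setLIntegral_mono' hQm fun y hy => ?_
        refine (enorm_sub_sq_le_lintegral_fderiv hU hf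
          ((hQ.segment_subset hx hy).trans hQU)).trans ?_
        gcongr
        rw [← ofReal_norm]
        exact ENNReal.ofReal_le_ofReal (hd x hx y hy)
    _ = ENNReal.ofReal d ^ 2 * ∫⁻ x in Q, ∫⁻ y in Q,
          (∫⁻ t in Ioc (0 : ℝ) 1, g (x + t • (y - x))) ∂μ ∂μ := by
        rw [← lintegral_const_mul']
        · refine lintegral_congr fun x => ?_
          rw [lintegral_const_mul' _ _ (by finiteness)]
        · finiteness
    _ = ENNReal.ofReal d ^ 2 * ∫⁻ t in Ioc (0 : ℝ) 1, ∫⁻ x in Q, ∫⁻ y in Q,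
          g (x + t • (y - x)) ∂μ ∂μ := by
        congr 1
        have h1 (x : E) : ∫⁻ y in Q, (∫⁻ t in Ioc (0 : ℝ) 1, g (x + t • (y - x))) ∂μ =
            ∫⁻ t in Ioc (0 : ℝ) 1, ∫⁻ y in Q, g (x + t • (y - x)) ∂μ := by
          refine lintegral_lintegral_swap ?_
          have : Measurable fun p : E × ℝ => g (x + p.2 • (p.1 - x)) := hgm.comp (by fun_prop)
          exact this.aemeasurable
        simp only [h1]
        refine lintegral_lintegral_swap ?_
        have : Measurable fun p : (E × ℝ) × E => g (p.1.1 + p.1.2 • (p.2 - p.1.1)) :=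
          hgm.comp (by fun_prop)
        exact (Measurable.lintegral_prod_right' this).aemeasurable
    _ ≤ ENNReal.ofReal d ^ 2 * ∫⁻ _ in Ioc (0 : ℝ) 1,
          2 ^ Module.finrank ℝ E * μ Q * ∫⁻ z in Q, g z ∂μ := by
        gcongr 1
        exact setLIntegral_mono' measurableSet_Ioc hslice
    _ = _ := by rw [setLIntegral_const]; simp

/-- The variance identity: the double integral of the squared difference equals
`2 ν(univ) ∫ f² - 2 (∫ f)²`. -/
theorem lintegral_lintegral_enorm_sub_sq {α : Type*} [MeasurableSpace α] {ν : Measure α}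
    [IsFiniteMeasure ν] {f : α → ℝ} (hf : MemLp f 2 ν) :
    ∫⁻ x, ∫⁻ y, ‖f x - f y‖ₑ ^ 2 ∂ν ∂ν =
      ENNReal.ofReal (2 * (ν.real univ * ∫ x, f x ^ 2 ∂ν - (∫ x, f x ∂ν) ^ 2)) := by
  have h1 : Integrable f ν := hf.integrable one_le_two
  have h2 : Integrable (fun x => f x ^ 2) ν := hf.integrable_sq
  have hexp (x : α) : (fun y => (f x - f y) ^ 2) =
      fun y => f x ^ 2 - 2 * f x * f y + f y ^ 2 := by
    ext y; ring
  have hint (x : α) : Integrable (fun y => (f x - f y) ^ 2) ν := by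
    rw [hexp x]; fun_prop
  have hin (x : α) : ∫ y, (f x - f y) ^ 2 ∂ν =
      ν.real univ * f x ^ 2 - 2 * (∫ y, f y ∂ν) * f x + ∫ y, f y ^ 2 ∂ν := by
    rw [hexp x, integral_add (by fun_prop) h2, integral_sub (by fun_prop) (by fun_prop),
      integral_const_mul, integral_const, smul_eq_mul]
    ring
  have hout : Integrable (fun x => ∫ y, (f x - f y) ^ 2 ∂ν) ν := by
    simp only [hin]; fun_prop
  have henorm (x y : α) : ‖f x - f y‖ₑ ^ 2 = ENNReal.ofReal ((f x - f y) ^ 2) := by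
    rw [← ofReal_norm, ← ENNReal.ofReal_pow (norm_nonneg _), Real.norm_eq_abs, sq_abs]
  calc ∫⁻ x, ∫⁻ y, ‖f x - f y‖ₑ ^ 2 ∂ν ∂ν
      = ∫⁻ x, ENNReal.ofReal (∫ y, (f x - f y) ^ 2 ∂ν) ∂ν := by
        refine lintegral_congr fun x => ?_
        rw [ofReal_integral_eq_lintegral_ofReal (hint x)
          (Filter.Eventually.of_forall fun y => sq_nonneg _)]
        simp only [henorm]
    _ = ENNReal.ofReal (∫ x, ∫ y, (f x - f y) ^ 2 ∂ν ∂ν) :=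
        (ofReal_integral_eq_lintegral_ofReal hout (Filter.Eventually.of_forall fun x =>
          integral_nonneg fun y => sq_nonneg _)).symm
    _ = _ := by
        congr 1
        simp only [hin]
        rw [integral_add (by fun_prop) (by fun_prop), integral_sub (by fun_prop) (by fun_prop),
          integral_const_mul, integral_const_mul, integral_const, smul_eq_mul]
        ring

/-- A bounded convex set in Euclidean space is cut by a cubical grid into finitely many disjoint
convex sets of small diameter. -/
theorem exists_finite_convex_partition {n : ℕ} {K : Set (EuclideanSpace ℝ (Fin n))}
    (hKb : Bornology.IsBounded K) (hKc : Convex ℝ K) (hKm : MeasurableSet K) {δ : ℝ} (hδ : 0 < δ) :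
    ∃ (t : Finset (Fin n → ℤ)) (Q : (Fin n → ℤ) → Set (EuclideanSpace ℝ (Fin n))),
      (∀ k, Convex ℝ (Q k) ∧ MeasurableSet (Q k) ∧ Q k ⊆ K ∧
        ∀ x ∈ Q k, ∀ y ∈ Q k, ‖y - x‖ ≤ δ) ∧
      Pairwise (Function.onFun Disjoint Q) ∧ K ⊆ ⋃ k ∈ t, Q k := by
  set h : ℝ := δ / (n + 1) with hh
  have hh0 : 0 < h := by positivity
  let C (k : Fin n → ℤ) : Set (EuclideanSpace ℝ (Fin n)) :=
    ⋂ i, {y | (k i : ℝ) * h ≤ y i ∧ y i < (k i + 1) * h}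
  have hC (k : Fin n → ℤ) (y : EuclideanSpace ℝ (Fin n)) :
      y ∈ C k ↔ ∀ i, ⌊y i / h⌋ = k i := by
    simp only [C, mem_iInter, mem_ofPred_eq, Int.floor_eq_iff, le_div_iff₀ hh0, div_lt_iff₀ hh0]
  obtain ⟨R, -, hR⟩ := hKb.subset_closedBall_lt 0 0
  refine ⟨Fintype.piFinset fun _ => Finset.Icc ⌊-R / h⌋ ⌊R / h⌋, fun k => K ∩ C k,
    fun k => ⟨?_, ?_, inter_subset_left, ?_⟩, ?_, ?_⟩
  · refine hKc.inter (convex_iInter fun i => ?_)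
    exact (convex_Ico ((k i : ℝ) * h) ((k i + 1) * h)).is_linear_preimage
      (EuclideanSpace.proj (𝕜 := ℝ) i : EuclideanSpace ℝ (Fin n) →L[ℝ] ℝ).toLinearMap.isLinear
  · refine hKm.inter (MeasurableSet.iInter fun i => ?_)
    exact (EuclideanSpace.proj (𝕜 := ℝ) i :
      EuclideanSpace ℝ (Fin n) →L[ℝ] ℝ).continuous.measurable measurableSet_Ico
  · intro x hx y hy
    have hi (i : Fin n) : (y i - x i) ^ 2 ≤ h ^ 2 := by
      have h1 := mem_iInter.1 hx.2 i
      have h2 := mem_iInter.1 hy.2 i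
      simp only [mem_ofPred_eq] at h1 h2
      rw [← sq_abs]
      gcongr
      rw [abs_le]
      constructor <;> linarith
    refine le_of_sq_le_sq ?_ hδ.le
    rw [EuclideanSpace.real_norm_sq_eq]
    calc ∑ i, (y - x) i ^ 2 ≤ ∑ _i : Fin n, h ^ 2 := Finset.sum_le_sum fun i _ => hi i
      _ = n / (n + 1) ^ 2 * δ ^ 2 := by
          rw [Finset.sum_const, Finset.card_univ, Fintype.card_fin, nsmul_eq_mul, hh]
          field_simp
      _ ≤ 1 * δ ^ 2 := by
          gcongr
          rw [div_le_one (by positivity)]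
          nlinarith [(Nat.cast_nonneg n : (0 : ℝ) ≤ _)]
      _ = _ := one_mul _
  · intro k l hkl
    refine Set.disjoint_left.2 fun y hyk hyl => hkl (funext fun i => ?_)
    rw [← (hC k y).1 hyk.2 i, (hC l y).1 hyl.2 i]
  · intro y hy
    refine mem_iUnion₂.2 ⟨fun i => ⌊y i / h⌋, ?_, hy, (hC _ y).2 fun i => rfl⟩
    rw [Fintype.mem_piFinset]
    intro i
    have h1 : |y i| ≤ R := (PiLp.norm_apply_le y i).trans (mem_closedBall_zero_iff.1 (hR hy))
    have h2 := abs_le.1 h1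
    rw [Finset.mem_Icc]
    constructor <;> gcongr <;> linarith

end Poincare

/-! ### The metric and the volume in charts -/

section Charts

open Set
open scoped ENNReal

variable {n : ℕ} {M : Type*} [TopologicalSpace M] [ChartedSpace (EuclideanSpace ℝ (Fin n)) M]
  [IsManifold (𝓡 n) ∞ M] [RiemannianBundle (fun x : M => TangentSpace (𝓡 n) x)]

/-- The differential of the inverse of the chart around `x`. -/
abbrev chartDiff (x : M) (y : EuclideanSpace ℝ (Fin n)) :
    EuclideanSpace ℝ (Fin n) →L[ℝ] TangentSpace (𝓡 n) ((extChartAt (𝓡 n) x).symm y) :=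
  mfderiv 𝓘(ℝ, EuclideanSpace ℝ (Fin n)) (𝓡 n) (extChartAt (𝓡 n) x).symm y

theorem chartGram_apply (x : M) (y : EuclideanSpace ℝ (Fin n)) (i j : Fin n) :
    chartGram n M x y i j = ⟪chartDiff x y (EuclideanSpace.single i (1 : ℝ)),
      chartDiff x y (EuclideanSpace.single j (1 : ℝ))⟫ := rfl

theorem chartDiff_injective {x : M} {y : EuclideanSpace ℝ (Fin n)}
    (hy : y ∈ (extChartAt (𝓡 n) x).target) : Function.Injective (chartDiff x y) := by
  have h := isInvertible_mfderivWithin_extChartAt_symm hy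
  rw [ModelWithCorners.range_eq_univ, mfderivWithin_univ] at h
  exact h.injective

theorem mdifferentiableAt_chart_symm {x : M} {y : EuclideanSpace ℝ (Fin n)}
    (hy : y ∈ (extChartAt (𝓡 n) x).target) :
    MDifferentiableAt 𝓘(ℝ, EuclideanSpace ℝ (Fin n)) (𝓡 n) (extChartAt (𝓡 n) x).symm y := by
  have h := mdifferentiableWithinAt_extChartAt_symm (I := 𝓡 n) hy
  rwa [ModelWithCorners.range_eq_univ, mdifferentiableWithinAt_univ] at h

theorem chartGram_det_pos {x : M} {y : EuclideanSpace ℝ (Fin n)}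
    (hy : y ∈ (extChartAt (𝓡 n) x).target) : 0 < (chartGram n M x y).det := by
  have hli : LinearIndependent ℝ fun i : Fin n =>
      chartDiff x y (EuclideanSpace.single i (1 : ℝ)) := by
    have h := (EuclideanSpace.basisFun (Fin n) ℝ).toBasis.linearIndependent.map'
      (chartDiff x y).toLinearMap (LinearMap.ker_eq_bot.2 (chartDiff_injective hy))
    have hfun : (fun i : Fin n => chartDiff x y (EuclideanSpace.single i (1 : ℝ))) =
        (chartDiff x y).toLinearMap ∘ (EuclideanSpace.basisFun (Fin n) ℝ).toBasis := by
      ext i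
      simp
      rfl
    rw [hfun]
    exact h
  have : chartGram n M x y = Matrix.gram ℝ fun i : Fin n =>
      chartDiff x y (EuclideanSpace.single i (1 : ℝ)) := rfl
  rw [this]
  exact (Matrix.posDef_gram_of_linearIndependent hli).det_pos

theorem chartDiff_eq_sum (x : M) (y v : EuclideanSpace ℝ (Fin n)) :
    chartDiff x y v = ∑ i, v i • chartDiff x y (EuclideanSpace.single i (1 : ℝ)) := by
  conv_lhs => rw [← (EuclideanSpace.basisFun (Fin n) ℝ).sum_repr v]
  simp only [map_sum, map_smul, EuclideanSpace.basisFun_repr, EuclideanSpace.basisFun_apply]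

theorem inner_chartDiff (x : M) (y v w : EuclideanSpace ℝ (Fin n)) :
    ⟪chartDiff x y v, chartDiff x y w⟫ = ∑ i, ∑ j, v i * w j * chartGram n M x y i j := by
  rw [chartDiff_eq_sum x y v, chartDiff_eq_sum x y w]
  simp only [sum_inner, inner_sum, real_inner_smul_left, real_inner_smul_right, chartGram_apply]
  rw [Finset.sum_comm]
  exact Finset.sum_congr rfl fun i _ => Finset.sum_congr rfl fun j _ => by ring

/-- The metric at equal base points; all tangent spaces are identified with the model space. -/
theorem inner_eq_of_base_eq {p q : M} (h : p = q)
    {v w : TangentSpace (𝓡 n) p} {v' w' : TangentSpace (𝓡 n) q}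
    (hv : (v : EuclideanSpace ℝ (Fin n)) = v') (hw : (w : EuclideanSpace ℝ (Fin n)) = w') :
    ⟪v, w⟫ = ⟪v', w'⟫ := by
  subst h
  cases hv
  cases hw
  rfl

/-- The transformation rule of the Gram determinant under a change of charts. -/
theorem chart_transition {x x' : M} {y : EuclideanSpace ℝ (Fin n)}
    (hy : y ∈ (extChartAt (𝓡 n) x).target)
    (hy' : (extChartAt (𝓡 n) x).symm y ∈ (extChartAt (𝓡 n) x').source) :
    ∃ L : EuclideanSpace ℝ (Fin n) →L[ℝ] EuclideanSpace ℝ (Fin n),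
      HasFDerivAt (extChartAt (𝓡 n) x' ∘ (extChartAt (𝓡 n) x).symm) L y ∧
      (chartGram n M x y).det =
        L.det ^ 2 * (chartGram n M x' (extChartAt (𝓡 n) x' ((extChartAt (𝓡 n) x).symm y))).det := by
  set τ := extChartAt (𝓡 n) x' ∘ (extChartAt (𝓡 n) x).symm with hτ
  have h1 : MDifferentiableAt 𝓘(ℝ, EuclideanSpace ℝ (Fin n)) 𝓘(ℝ, EuclideanSpace ℝ (Fin n)) τ y :=
    (mdifferentiableAt_extChartAt (by rwa [extChartAt_source] at hy')).comp y
      (mdifferentiableAt_chart_symm hy)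
  have hτy : τ y ∈ (extChartAt (𝓡 n) x').target := (extChartAt (𝓡 n) x').map_source hy'
  have hev : (extChartAt (𝓡 n) x).symm =ᶠ[nhds y] (extChartAt (𝓡 n) x').symm ∘ τ := by
    have hcont : ContinuousAt (extChartAt (𝓡 n) x).symm y :=
      (mdifferentiableAt_chart_symm hy).continuousAt
    filter_upwards [hcont.preimage_mem_nhds ((isOpen_extChartAt_source x').mem_nhds hy')] with z hz
    exact ((extChartAt (𝓡 n) x').left_inv hz).symm
  set L : EuclideanSpace ℝ (Fin n) →L[ℝ] EuclideanSpace ℝ (Fin n) := fderiv ℝ τ y with hL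
  refine ⟨L, h1.differentiableAt.hasFDerivAt, ?_⟩
  have hcomp (v : EuclideanSpace ℝ (Fin n)) :
      (chartDiff x y v : EuclideanSpace ℝ (Fin n)) = chartDiff x' (τ y) (L v) := by
    have h2 := hev.mfderiv_eq (I := 𝓘(ℝ, EuclideanSpace ℝ (Fin n))) (I' := 𝓡 n)
    have h3 := mfderiv_comp y (mdifferentiableAt_chart_symm hτy) h1
    rw [mfderiv_eq_fderiv] at h3
    exact congrArg (fun A : EuclideanSpace ℝ (Fin n) →L[ℝ] EuclideanSpace ℝ (Fin n) => A v)
      (h2.trans h3)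
  have hbase : (extChartAt (𝓡 n) x).symm y = (extChartAt (𝓡 n) x').symm (τ y) :=
    hev.self_of_nhds
  let b := (EuclideanSpace.basisFun (Fin n) ℝ).toBasis
  set J : Matrix (Fin n) (Fin n) ℝ := LinearMap.toMatrix b b L.toLinearMap with hJ
  have hJapply (i k : Fin n) : J k i = L (EuclideanSpace.single i (1 : ℝ)) k := by
    simp [hJ, LinearMap.toMatrix_apply, b]
  have hgram : chartGram n M x y = Jᵀ * chartGram n M x' (τ y) * J := by
    ext i j
    rw [chartGram_apply, inner_eq_of_base_eq hbase (hcomp _) (hcomp _), inner_chartDiff,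
      Matrix.mul_apply, Finset.sum_comm]
    refine Finset.sum_congr rfl fun l _ => ?_
    rw [Matrix.mul_apply, Finset.sum_mul]
    refine Finset.sum_congr rfl fun k _ => ?_
    rw [Matrix.transpose_apply, hJapply, hJapply]
    ring
  have hdet : J.det = L.det := LinearMap.det_toMatrix b L.toLinearMap
  rw [hgram, Matrix.det_mul, Matrix.det_mul, Matrix.det_transpose, hdet]
  simp only [hτ, Function.comp]
  ring

variable [IsContMDiffRiemannianBundle (𝓡 n) ∞ (EuclideanSpace ℝ (Fin n))
    (fun x : M => TangentSpace (𝓡 n) x)]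

/-- The coordinate frame of a chart is the local frame of the corresponding trivialization of the
tangent bundle, which is smooth. -/
theorem continuousOn_chartGram (x : M) :
    ContinuousOn (chartGram n M x) (extChartAt (𝓡 n) x).target := by
  let e := trivializationAt (EuclideanSpace ℝ (Fin n)) (fun x : M => TangentSpace (𝓡 n) x) x
  let b := (EuclideanSpace.basisFun (Fin n) ℝ).toBasis
  let s := e.localFrame b
  have hframe (y) (hy : y ∈ (extChartAt (𝓡 n) x).target) (i : Fin n) :
      chartDiff x y (EuclideanSpace.single i (1 : ℝ)) = s i ((extChartAt (𝓡 n) x).symm y) := by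
    have hs : (extChartAt (𝓡 n) x).symm y ∈ (chartAt (EuclideanSpace ℝ (Fin n)) x).source := by
      rw [← extChartAt_source (𝓡 n)]; exact (extChartAt (𝓡 n) x).map_target hy
    have h1 := TangentBundle.symmL_trivializationAt (I := 𝓡 n) hs
    rw [ModelWithCorners.range_eq_univ, mfderivWithin_univ,
      (extChartAt (𝓡 n) x).right_inv hy] at h1
    have hb : (extChartAt (𝓡 n) x).symm y ∈ e.baseSet := by simpa [e] using hs
    simp only [s]
    rw [e.localFrame_apply_of_mem_baseSet b hb, chartDiff, ← h1, Trivialization.basisAt,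
      Module.Basis.map_apply, OrthonormalBasis.coe_toBasis, EuclideanSpace.basisFun_apply,
      Trivialization.symmL_apply _ hb]
    rfl
  have hcont (i j : Fin n) : ContinuousOn (fun p => ⟪s i p, s j p⟫) e.baseSet := fun p hp =>
    (ContMDiffAt.inner_bundle (contMDiffAt_localFrame_of_mem (I := 𝓡 n) ∞ e b i hp)
      (contMDiffAt_localFrame_of_mem (I := 𝓡 n) ∞ e b j hp)).continuousAt.continuousWithinAt
  refine continuousOn_pi.2 fun i => continuousOn_pi.2 fun j => ?_
  refine ((hcont i j).comp (continuousOn_extChartAt_symm x) fun y hy => ?_).congr fun y hy => ?_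
  · simpa [e] using (extChartAt (𝓡 n) x).map_target hy
  · simp only [chartGram_apply, hframe y hy, Function.comp]


/-! ### The Riemannian volume agrees with the chart measures -/

variable (n) in
/-- The density `√(det g_ij)` of the volume in the chart around `x`. -/
def chartDensity (x : M) (y : EuclideanSpace ℝ (Fin n)) : ℝ≥0∞ :=
  ENNReal.ofReal √(chartGram n M x y).det

theorem chartDensity_transition {x x' : M} {y : EuclideanSpace ℝ (Fin n)}
    (hy : y ∈ (extChartAt (𝓡 n) x).target)
    (hy' : (extChartAt (𝓡 n) x).symm y ∈ (extChartAt (𝓡 n) x').source) :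
    ∃ L : EuclideanSpace ℝ (Fin n) →L[ℝ] EuclideanSpace ℝ (Fin n),
      HasFDerivAt (extChartAt (𝓡 n) x' ∘ (extChartAt (𝓡 n) x).symm) L y ∧
      chartDensity n x y = ENNReal.ofReal |L.det| *
        chartDensity n x' (extChartAt (𝓡 n) x' ((extChartAt (𝓡 n) x).symm y)) := by
  obtain ⟨L, hL, hdet⟩ := chart_transition hy hy'
  refine ⟨L, hL, ?_⟩
  rw [chartDensity, chartDensity, hdet, Real.sqrt_mul (sq_nonneg _), Real.sqrt_sq_eq_abs,
    ENNReal.ofReal_mul (abs_nonneg _)]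

theorem continuousOn_sqrt_det_chartGram (x : M) :
    ContinuousOn (fun y => √(chartGram n M x y).det) (extChartAt (𝓡 n) x).target :=
  ((Continuous.matrix_det (A := fun N : Matrix (Fin n) (Fin n) ℝ => N)
      continuous_id).comp_continuousOn (continuousOn_chartGram x)).sqrt

variable [MeasurableSpace M] [BorelSpace M]

variable (n) in
/-- The measure `√(det g_ij) dy` on the domain of the chart around `x`. -/
def chartMeasure (x : M) : Measure M :=
  Measure.map (extChartAt (𝓡 n) x).symm
    ((volume.restrict (extChartAt (𝓡 n) x).target).withDensity (chartDensity n x))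

theorem riemannianVolume_eq_iSup : riemannianVolume n M = ⨆ x : M, chartMeasure n x := rfl

theorem measurableSet_chart_target (x : M) : MeasurableSet (extChartAt (𝓡 n) x).target :=
  (isOpen_extChartAt_target x).measurableSet

theorem measurableSet_chart_source (x : M) : MeasurableSet (extChartAt (𝓡 n) x).source :=
  (isOpen_extChartAt_source x).measurableSet

theorem aemeasurable_chartDensity (x : M) :
    AEMeasurable (chartDensity n x) (volume.restrict (extChartAt (𝓡 n) x).target) :=
  ((continuousOn_sqrt_det_chartGram x).aemeasurable (measurableSet_chart_target x)).ennreal_ofReal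

theorem aemeasurable_chart_symm (x : M) : AEMeasurable (extChartAt (𝓡 n) x).symm
    (volume.restrict (extChartAt (𝓡 n) x).target) :=
  (continuousOn_extChartAt_symm x).aemeasurable (measurableSet_chart_target x)

theorem measurableSet_target_inter_preimage (x : M) {S : Set M} (hS : MeasurableSet S) :
    MeasurableSet ((extChartAt (𝓡 n) x).target ∩ (extChartAt (𝓡 n) x).symm ⁻¹' S) := by
  have h := (measurableSet_chart_target x).subtype_image
    ((continuousOn_iff_continuous_domRestrict.1
      (continuousOn_extChartAt_symm (I := 𝓡 n) x)).measurable hS)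
  rwa [Set.domRestrict_eq, preimage_comp, Subtype.image_preimage_coe] at h

theorem measurableSet_source_inter_preimage (x : M) {Q : Set (EuclideanSpace ℝ (Fin n))}
    (hQ : MeasurableSet Q) :
    MeasurableSet ((extChartAt (𝓡 n) x).source ∩ extChartAt (𝓡 n) x ⁻¹' Q) := by
  have h := (measurableSet_chart_source x).subtype_image
    ((continuousOn_iff_continuous_domRestrict.1
      (continuousOn_extChartAt (I := 𝓡 n) x)).measurable hQ)
  rwa [Set.domRestrict_eq, preimage_comp, Subtype.image_preimage_coe] at h

theorem lintegral_chartMeasure (x : M) {f : M → ℝ≥0∞} (hf : Measurable f) :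
    ∫⁻ p, f p ∂chartMeasure n x =
      ∫⁻ y in (extChartAt (𝓡 n) x).target,
        chartDensity n x y * f ((extChartAt (𝓡 n) x).symm y) := by
  have hm : AEMeasurable (extChartAt (𝓡 n) x).symm
      ((volume.restrict (extChartAt (𝓡 n) x).target).withDensity (chartDensity n x)) :=
    (aemeasurable_chart_symm x).mono_ac (withDensity_absolutelyContinuous _ _)
  rw [chartMeasure, lintegral_map' hf.aemeasurable hm,
    lintegral_withDensity_eq_lintegral_mul₀ (g := fun y => f ((extChartAt (𝓡 n) x).symm y))
      (aemeasurable_chartDensity x)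
      (hf.comp_aemeasurable (aemeasurable_chart_symm x))]
  rfl

theorem chartMeasure_apply (x : M) {S : Set M} (hS : MeasurableSet S) :
    chartMeasure n x S =
      ∫⁻ y in (extChartAt (𝓡 n) x).target ∩ (extChartAt (𝓡 n) x).symm ⁻¹' S,
        chartDensity n x y := by
  have hT := measurableSet_chart_target (n := n) x
  rw [← lintegral_indicator_one hS, lintegral_chartMeasure x (measurable_one.indicator hS),
    ← lintegral_indicator hT, ← lintegral_indicator (measurableSet_target_inter_preimage x hS)]
  refine lintegral_congr fun y => ?_
  by_cases h1 : y ∈ (extChartAt (𝓡 n) x).target <;>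
    by_cases h2 : (extChartAt (𝓡 n) x).symm y ∈ S <;> simp [-extChartAt, indicator, h1, h2]

/-- The chart measures agree on the overlaps of the chart domains, by the change of variables
formula. -/
theorem chartMeasure_eq_of_subset {x x' : M} {S : Set M} (hS : MeasurableSet S)
    (hx : S ⊆ (extChartAt (𝓡 n) x).source) (hx' : S ⊆ (extChartAt (𝓡 n) x').source) :
    chartMeasure n x S = chartMeasure n x' S := by
  set s := (extChartAt (𝓡 n) x).target ∩ (extChartAt (𝓡 n) x).symm ⁻¹' S with hs
  have hsm : MeasurableSet s := measurableSet_target_inter_preimage x hS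
  have hex : ∀ y ∈ s, _ := fun y hy => chartDensity_transition hy.1 (hx' hy.2)
  choose! L hL hdet using hex
  set τ := extChartAt (𝓡 n) x' ∘ (extChartAt (𝓡 n) x).symm with hτ
  have hinj : InjOn τ s := fun y hy z hz h =>
    (extChartAt (𝓡 n) x).symm.injOn hy.1 hz.1
      ((extChartAt (𝓡 n) x').injOn (hx' hy.2) (hx' hz.2) h)
  have himage : τ '' s =
      (extChartAt (𝓡 n) x').target ∩ (extChartAt (𝓡 n) x').symm ⁻¹' S := by
    ext z
    constructor
    · rintro ⟨y, hy, rfl⟩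
      refine ⟨(extChartAt (𝓡 n) x').map_source (hx' hy.2), ?_⟩
      simp only [mem_preimage, hτ, Function.comp]
      rw [(extChartAt (𝓡 n) x').left_inv (hx' hy.2)]
      exact hy.2
    · rintro ⟨hz, hzS⟩
      refine ⟨extChartAt (𝓡 n) x ((extChartAt (𝓡 n) x').symm z),
        ⟨(extChartAt (𝓡 n) x).map_source (hx hzS), ?_⟩, ?_⟩
      · rw [mem_preimage, (extChartAt (𝓡 n) x).left_inv (hx hzS)]
        exact hzS
      · simp only [hτ, Function.comp]
        rw [(extChartAt (𝓡 n) x).left_inv (hx hzS), (extChartAt (𝓡 n) x').right_inv hz]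
  rw [chartMeasure_apply x hS, chartMeasure_apply x' hS, ← himage,
    lintegral_image_eq_lintegral_abs_det_fderiv_mul volume hsm
      (fun y hy => (hL y hy).hasFDerivWithinAt) hinj]
  exact setLIntegral_congr_fun hsm hdet

theorem chartMeasure_compl_source (x : M) : chartMeasure n x (extChartAt (𝓡 n) x).sourceᶜ = 0 := by
  rw [chartMeasure_apply x (measurableSet_chart_source x).compl]
  have : (extChartAt (𝓡 n) x).target ∩
      (extChartAt (𝓡 n) x).symm ⁻¹' (extChartAt (𝓡 n) x).sourceᶜ = ∅ := by
    refine eq_empty_of_forall_notMem fun y hy => hy.2 ((extChartAt (𝓡 n) x).map_target hy.1)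
  rw [this, Measure.restrict_empty, lintegral_zero_measure]

theorem chartMeasure_restrict_le (x x' : M) :
    (chartMeasure n x).restrict (extChartAt (𝓡 n) x').source ≤ chartMeasure n x' := by
  refine Measure.le_iff.2 fun S hS => ?_
  have h1 := measurableSet_chart_source (n := n) x
  have h2 := measurableSet_chart_source (n := n) x'
  rw [Measure.restrict_apply hS]
  calc chartMeasure n x (S ∩ (extChartAt (𝓡 n) x').source)
      ≤ chartMeasure n x (S ∩ (extChartAt (𝓡 n) x').source ∩ (extChartAt (𝓡 n) x).source) +
        chartMeasure n x (extChartAt (𝓡 n) x).sourceᶜ :=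
        (measure_le_inter_add_sdiff _ _ _).trans (by gcongr; exact sdiff_subset_compl _ _)
    _ = chartMeasure n x' (S ∩ (extChartAt (𝓡 n) x').source ∩ (extChartAt (𝓡 n) x).source) := by
        rw [chartMeasure_compl_source, add_zero]
        exact chartMeasure_eq_of_subset ((hS.inter h2).inter h1) inter_subset_right
          (inter_subset_left.trans inter_subset_right)
    _ ≤ chartMeasure n x' S :=
        measure_mono (inter_subset_left.trans inter_subset_left)

/-- The volume restricts to the chart measure on each chart domain: no other chart contributes
more. -/
theorem riemannianVolume_restrict_source (x : M) :
    (riemannianVolume n M).restrict (extChartAt (𝓡 n) x).source = chartMeasure n x := by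
  have hm := measurableSet_chart_source (n := n) x
  have hle : riemannianVolume n M ≤ chartMeasure n x +
      (riemannianVolume n M).restrict (extChartAt (𝓡 n) x).sourceᶜ := by
    conv_lhs => rw [riemannianVolume_eq_iSup]
    refine iSup_le fun z => ?_
    rw [← Measure.restrict_add_restrict_compl (μ := chartMeasure n z) hm]
    refine add_le_add (chartMeasure_restrict_le z x) (Measure.restrict_mono le_rfl ?_)
    exact le_iSup (fun z : M => chartMeasure n z) z
  refine le_antisymm ?_ ?_
  · refine (Measure.restrict_mono le_rfl hle).trans ?_
    rw [Measure.restrict_add, Measure.restrict_restrict hm]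
    simp only [inter_compl_self, Measure.restrict_empty, add_zero]
    exact Measure.restrict_le_self
  · have h1 : (chartMeasure n x).restrict (extChartAt (𝓡 n) x).source = chartMeasure n x :=
      Measure.restrict_eq_self_of_ae_mem (by
        rw [ae_iff]; exact chartMeasure_compl_source x)
    rw [← h1]
    exact Measure.restrict_mono le_rfl (le_iSup (fun z : M => chartMeasure n z) x)

/-- Integration over the part of a chart domain with coordinates in `Q`. -/
theorem setLIntegral_riemannianVolume (x : M) {Q : Set (EuclideanSpace ℝ (Fin n))}
    (hQ : MeasurableSet Q) (hQt : Q ⊆ (extChartAt (𝓡 n) x).target) {f : M → ℝ≥0∞}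
    (hf : Measurable f) :
    ∫⁻ p in (extChartAt (𝓡 n) x).source ∩ extChartAt (𝓡 n) x ⁻¹' Q, f p ∂riemannianVolume n M =
      ∫⁻ y in Q, chartDensity n x y * f ((extChartAt (𝓡 n) x).symm y) := by
  set S := (extChartAt (𝓡 n) x).source ∩ extChartAt (𝓡 n) x ⁻¹' Q with hS
  have hT := measurableSet_chart_target (n := n) x
  have hSm : MeasurableSet S := measurableSet_source_inter_preimage x hQ
  have hres : (riemannianVolume n M).restrict S = (chartMeasure n x).restrict S := by
    rw [← riemannianVolume_restrict_source, Measure.restrict_restrict hSm,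
      inter_eq_left.2 inter_subset_left]
  rw [hres, ← lintegral_indicator hSm, lintegral_chartMeasure x (hf.indicator hSm),
    ← lintegral_indicator hT, ← lintegral_indicator hQ]
  refine lintegral_congr fun y => ?_
  by_cases hy : y ∈ (extChartAt (𝓡 n) x).target
  · have hmem : (extChartAt (𝓡 n) x).symm y ∈ S ↔ y ∈ Q := by
      rw [hS, mem_inter_iff, mem_preimage, (extChartAt (𝓡 n) x).right_inv hy]
      exact and_iff_right ((extChartAt (𝓡 n) x).map_target hy)
    by_cases hyQ : y ∈ Q
    · rw [indicator_of_mem hy, indicator_of_mem hyQ, indicator_of_mem (hmem.2 hyQ)]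
    · rw [indicator_of_mem hy, indicator_of_notMem hyQ, indicator_of_notMem (mt hmem.1 hyQ),
        mul_zero]
  · rw [indicator_of_notMem hy, indicator_of_notMem (mt (@hQt y) hy)]

theorem riemannianVolume_apply (x : M) {Q : Set (EuclideanSpace ℝ (Fin n))}
    (hQ : MeasurableSet Q) (hQt : Q ⊆ (extChartAt (𝓡 n) x).target) :
    riemannianVolume n M ((extChartAt (𝓡 n) x).source ∩ extChartAt (𝓡 n) x ⁻¹' Q) =
      ∫⁻ y in Q, chartDensity n x y := by
  have h := setLIntegral_riemannianVolume x hQ hQt measurable_one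
  simpa using h

theorem exists_closedBall_subset_target (x : M) : ∃ r > 0,
    Metric.closedBall (extChartAt (𝓡 n) x x) r ⊆ (extChartAt (𝓡 n) x).target :=
  Metric.nhds_basis_closedBall.mem_iff.1 (extChartAt_target_mem_nhds x)

theorem chart_closedBall_mem_nhds (x : M) {r : ℝ} (hr : 0 < r) :
    (extChartAt (𝓡 n) x).source ∩
      extChartAt (𝓡 n) x ⁻¹' Metric.closedBall (extChartAt (𝓡 n) x x) r ∈ nhds x :=
  Filter.inter_mem (extChartAt_source_mem_nhds x)
    ((continuousAt_extChartAt x).preimage_mem_nhds (Metric.closedBall_mem_nhds _ hr))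

/-- On a compact set of coordinates the metric is comparable to the Euclidean metric. -/
theorem exists_chartGram_bounds (x : M) {K : Set (EuclideanSpace ℝ (Fin n))} (hK : IsCompact K)
    (hKt : K ⊆ (extChartAt (𝓡 n) x).target) : ∃ a b c : ℝ, 0 < a ∧ 0 < b ∧ 0 < c ∧ ∀ y ∈ K,
      a ≤ √(chartGram n M x y).det ∧ √(chartGram n M x y).det ≤ b ∧
        (chartGram n M x y).trace ≤ c := by
  have h1 := (continuousOn_sqrt_det_chartGram x).mono hKt
  have h2 : ContinuousOn (fun y => (chartGram n M x y).trace) K :=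
    (Continuous.matrix_trace (A := fun N : Matrix (Fin n) (Fin n) ℝ => N)
      continuous_id).comp_continuousOn ((continuousOn_chartGram x).mono hKt)
  obtain ⟨b, hb⟩ := hK.bddAbove_image h1
  obtain ⟨c, hc⟩ := hK.bddAbove_image h2
  obtain ⟨a, ha, hab⟩ := hK.exists_forall_le' (a := 0) h1
    fun y hy => Real.sqrt_pos.2 (chartGram_det_pos (hKt hy))
  exact ⟨a, max b 1, max c 1, ha, by positivity, by positivity, fun y hy =>
    ⟨hab y hy, (hb ⟨y, hy, rfl⟩).trans (le_max_left _ _),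
      (hc ⟨y, hy, rfl⟩).trans (le_max_left _ _)⟩⟩

/-- A compact Riemannian manifold has finite volume. -/
instance [CompactSpace M] : IsFiniteMeasure (riemannianVolume n M) := by
  have : IsLocallyFiniteMeasure (riemannianVolume n M) := by
    refine ⟨fun x => ?_⟩
    obtain ⟨r, hr, hrt⟩ := exists_closedBall_subset_target (n := n) x
    refine ⟨_, chart_closedBall_mem_nhds (n := n) x hr, ?_⟩
    have hK := isCompact_closedBall (extChartAt (𝓡 n) x x) r
    obtain ⟨a, b, c, -, -, -, h⟩ := exists_chartGram_bounds (n := n) x hK hrt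
    rw [riemannianVolume_apply x hK.measurableSet hrt]
    calc ∫⁻ y in Metric.closedBall (extChartAt (𝓡 n) x x) r, chartDensity n x y
        ≤ ∫⁻ _ in Metric.closedBall (extChartAt (𝓡 n) x x) r, ENNReal.ofReal b :=
          setLIntegral_mono' hK.measurableSet fun y hy => ENNReal.ofReal_le_ofReal (h y hy).2.1
      _ < ⊤ := by
          rw [setLIntegral_const]
          exact ENNReal.mul_lt_top ENNReal.ofReal_lt_top hK.measure_lt_top
  infer_instance

end Charts

/-! ### Compactness of the embedding of `H¹` into `L²` -/

section Rellich

open Set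
open scoped ENNReal

variable {n : ℕ} {M : Type u} [TopologicalSpace M] [ChartedSpace (EuclideanSpace ℝ (Fin n)) M]
  [IsManifold (𝓡 n) ∞ M] [RiemannianBundle (fun x : M => TangentSpace (𝓡 n) x)]

theorem norm_chartDiff_le (x : M) (y v : EuclideanSpace ℝ (Fin n)) :
    ‖chartDiff x y v‖ ≤ √(chartGram n M x y).trace * ‖v‖ := by
  have htr : (chartGram n M x y).trace =
      ∑ i, ‖chartDiff x y (EuclideanSpace.single i (1 : ℝ))‖ ^ 2 := by
    simp only [Matrix.trace, Matrix.diag_apply, chartGram_apply, real_inner_self_eq_norm_sq]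
  rw [htr, EuclideanSpace.norm_eq, mul_comm, chartDiff_eq_sum]
  calc ‖∑ i, v i • chartDiff x y (EuclideanSpace.single i (1 : ℝ))‖
      ≤ ∑ i, ‖v i‖ * ‖chartDiff x y (EuclideanSpace.single i (1 : ℝ))‖ :=
        (norm_sum_le _ _).trans_eq (Finset.sum_congr rfl fun i _ => norm_smul _ _)
    _ ≤ _ := Real.sum_mul_le_sqrt_mul_sqrt _ _ _

theorem norm_fderiv_comp_chart_symm_le {f : M → ℝ} (hf : ContMDiff (𝓡 n) 𝓘(ℝ, ℝ) ∞ f) {x : M}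
    {y : EuclideanSpace ℝ (Fin n)} (hy : y ∈ (extChartAt (𝓡 n) x).target) :
    ‖fderiv ℝ (f ∘ (extChartAt (𝓡 n) x).symm) y‖ ≤
      √(chartGram n M x y).trace * ‖grad n f ((extChartAt (𝓡 n) x).symm y)‖ := by
  refine ContinuousLinearMap.opNorm_le_bound _ (by positivity) fun v => ?_
  have h1 := mfderiv_comp y ((hf.mdifferentiable (by simp)) _) (mdifferentiableAt_chart_symm hy)
  rw [mfderiv_eq_fderiv] at h1
  have h2 : fderiv ℝ (f ∘ (extChartAt (𝓡 n) x).symm) y v =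
      ⟪grad n f ((extChartAt (𝓡 n) x).symm y), chartDiff x y v⟫ := by
    rw [grad, InnerProductSpace.toDual_symm_apply]
    exact congrArg (fun A : EuclideanSpace ℝ (Fin n) →L[ℝ] ℝ => A v) h1
  rw [h2]
  calc ‖⟪grad n f ((extChartAt (𝓡 n) x).symm y), chartDiff x y v⟫‖
      ≤ ‖grad n f ((extChartAt (𝓡 n) x).symm y)‖ * ‖chartDiff x y v‖ := norm_inner_le_norm _ _
    _ ≤ ‖grad n f ((extChartAt (𝓡 n) x).symm y)‖ * (√(chartGram n M x y).trace * ‖v‖) := by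
        gcongr
        exact norm_chartDiff_le x y v
    _ = _ := by ring

theorem contDiffOn_comp_chart_symm {f : M → ℝ} (hf : ContMDiff (𝓡 n) 𝓘(ℝ, ℝ) ∞ f) (x : M) :
    ContDiffOn ℝ 1 (f ∘ (extChartAt (𝓡 n) x).symm) (extChartAt (𝓡 n) x).target := by
  have h := hf.comp_contMDiffOn (contMDiffOn_extChartAt_symm (n := ∞) x)
  exact (contMDiffOn_iff_contDiffOn.1 h).of_le (by simp)

variable [IsContMDiffRiemannianBundle (𝓡 n) ∞ (EuclideanSpace ℝ (Fin n))
    (fun x : M => TangentSpace (𝓡 n) x)] [MeasurableSpace M] [BorelSpace M]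
  [CompactSpace M]

/-- The Poincaré inequality on the part of a chart domain with coordinates in a small convex set,
with a constant that is uniform for convex subsets of a compact set of coordinates. -/
theorem exists_poincare_constant (x : M) {K : Set (EuclideanSpace ℝ (Fin n))} (hK : IsCompact K)
    (hKt : K ⊆ (extChartAt (𝓡 n) x).target) :
    ∃ C : ℝ≥0∞, C ≠ ⊤ ∧ ∀ (Q : Set (EuclideanSpace ℝ (Fin n))) (d : ℝ), Convex ℝ Q →
      MeasurableSet Q → Q ⊆ K → (∀ y ∈ Q, ∀ z ∈ Q, ‖z - y‖ ≤ d) →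
      ∀ f : M → ℝ, ContMDiff (𝓡 n) 𝓘(ℝ, ℝ) ∞ f →
      let E := (extChartAt (𝓡 n) x).source ∩ extChartAt (𝓡 n) x ⁻¹' Q
      ∫⁻ p in E, ∫⁻ q in E, ‖f p - f q‖ₑ ^ 2 ∂riemannianVolume n M ∂riemannianVolume n M ≤
        C * ENNReal.ofReal d ^ 2 * riemannianVolume n M E *
          ∫⁻ p in E, ‖grad n f p‖ₑ ^ 2 ∂riemannianVolume n M := by
  obtain ⟨a, b, c, ha, hb, hc, habc⟩ := exists_chartGram_bounds (n := n) x hK hKt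
  refine ⟨ENNReal.ofReal b * ENNReal.ofReal b * 2 ^ n * ENNReal.ofReal a⁻¹ * ENNReal.ofReal a⁻¹ *
    ENNReal.ofReal c, by finiteness, fun Q d hQ hQm hQK hd f hf => ?_⟩
  have hQt := hQK.trans hKt
  set E := (extChartAt (𝓡 n) x).source ∩ extChartAt (𝓡 n) x ⁻¹' Q with hE
  set F := f ∘ (extChartAt (𝓡 n) x).symm with hF
  have hfm : Measurable f := hf.continuous.measurable
  have hgm : Measurable fun p => ‖grad n f p‖ₑ ^ 2 := by
    have h := ((continuous_norm_grad hf).measurable.ennreal_ofReal).pow_const 2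
    simpa only [ofReal_norm] using h
  have hle (y) (hy : y ∈ Q) : chartDensity n x y ≤ ENNReal.ofReal b :=
    ENNReal.ofReal_le_ofReal (habc y (hQK hy)).2.1
  have hge (y) (hy : y ∈ Q) : 1 ≤ ENNReal.ofReal a⁻¹ * chartDensity n x y := by
    rw [chartDensity, ← ENNReal.ofReal_mul (by positivity), ENNReal.one_le_ofReal,
      ← inv_mul_cancel₀ ha.ne']
    gcongr
    exact (habc y (hQK hy)).1
  have hosc : ∫⁻ p in E, ∫⁻ q in E, ‖f p - f q‖ₑ ^ 2 ∂riemannianVolume n M ∂riemannianVolume n M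
      ≤ ENNReal.ofReal b * ENNReal.ofReal b * ∫⁻ y in Q, ∫⁻ z in Q, ‖F y - F z‖ₑ ^ 2 := by
    have hm2 : Measurable fun p => ∫⁻ q in E, ‖f p - f q‖ₑ ^ 2 ∂riemannianVolume n M := by
      have h : Measurable fun p : M × M => ‖f p.1 - f p.2‖ₑ ^ 2 := by fun_prop
      exact h.lintegral_prod_right'
    rw [setLIntegral_riemannianVolume x hQm hQt hm2, mul_assoc,
      ← lintegral_const_mul' _ _ (by finiteness), ← lintegral_const_mul' _ _ (by finiteness)]
    refine setLIntegral_mono' hQm fun y hy => mul_le_mul' (hle y hy) ?_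
    rw [setLIntegral_riemannianVolume x hQm hQt (by fun_prop),
      ← lintegral_const_mul' _ _ (by finiteness)]
    exact setLIntegral_mono' hQm fun z hz => mul_le_mul' (hle z hz) le_rfl
  have hvol : volume Q ≤ ENNReal.ofReal a⁻¹ * riemannianVolume n M E := by
    rw [riemannianVolume_apply x hQm hQt, ← lintegral_const_mul' _ _ (by finiteness),
      ← setLIntegral_one]
    exact setLIntegral_mono' hQm hge
  have hgrad : ∫⁻ y in Q, ‖fderiv ℝ F y‖ₑ ^ 2 ≤
      ENNReal.ofReal a⁻¹ * (ENNReal.ofReal c *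
        ∫⁻ p in E, ‖grad n f p‖ₑ ^ 2 ∂riemannianVolume n M) := by
    rw [setLIntegral_riemannianVolume x hQm hQt hgm, ← lintegral_const_mul' _ _ (by finiteness),
      ← lintegral_const_mul' _ _ (by finiteness)]
    refine setLIntegral_mono' hQm fun y hy => ?_
    have h1 : ‖fderiv ℝ F y‖ₑ ^ 2 ≤
        ENNReal.ofReal c * ‖grad n f ((extChartAt (𝓡 n) x).symm y)‖ₑ ^ 2 := by
      have h2 := norm_fderiv_comp_chart_symm_le hf (hQt hy)
      rw [← ofReal_norm, ← ofReal_norm, ← ENNReal.ofReal_pow (norm_nonneg _),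
        ← ENNReal.ofReal_pow (norm_nonneg _), ← ENNReal.ofReal_mul hc.le]
      refine ENNReal.ofReal_le_ofReal ?_
      calc ‖fderiv ℝ F y‖ ^ 2
          ≤ (√(chartGram n M x y).trace * ‖grad n f ((extChartAt (𝓡 n) x).symm y)‖) ^ 2 := by
            gcongr
        _ ≤ (√c * ‖grad n f ((extChartAt (𝓡 n) x).symm y)‖) ^ 2 := by
            gcongr
            exact (habc y (hQK hy)).2.2
        _ = _ := by rw [mul_pow, Real.sq_sqrt hc.le]
    calc ‖fderiv ℝ F y‖ₑ ^ 2
        ≤ 1 * (ENNReal.ofReal c * ‖grad n f ((extChartAt (𝓡 n) x).symm y)‖ₑ ^ 2) := by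
          rwa [one_mul]
      _ ≤ ENNReal.ofReal a⁻¹ * chartDensity n x y *
          (ENNReal.ofReal c * ‖grad n f ((extChartAt (𝓡 n) x).symm y)‖ₑ ^ 2) := by
          gcongr
          exact hge y hy
      _ = _ := by ring
  have hpoin := lintegral_enorm_sub_sq_le volume (isOpen_extChartAt_target x)
    (contDiffOn_comp_chart_symm hf x) hQ hQm hQt hd
  rw [finrank_euclideanSpace_fin] at hpoin
  calc _ ≤ _ := hosc
    _ ≤ ENNReal.ofReal b * ENNReal.ofReal b * (ENNReal.ofReal d ^ 2 *
        (2 ^ n * (ENNReal.ofReal a⁻¹ * riemannianVolume n M E) *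
          (ENNReal.ofReal a⁻¹ * (ENNReal.ofReal c *
            ∫⁻ p in E, ‖grad n f p‖ₑ ^ 2 ∂riemannianVolume n M)))) := by
        refine mul_le_mul' le_rfl (hpoin.trans ?_)
        gcongr
    _ = _ := by ring

/-- The Poincaré inequality for the `L²` norm: on a small piece, a function is controlled by its
gradient and its mean. -/
theorem exists_poincare_constant_real (x : M) {K : Set (EuclideanSpace ℝ (Fin n))}
    (hK : IsCompact K) (hKt : K ⊆ (extChartAt (𝓡 n) x).target) :
    ∃ C : ℝ, 0 < C ∧ ∀ (Q : Set (EuclideanSpace ℝ (Fin n))) (d : ℝ), 0 < d → Convex ℝ Q →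
      MeasurableSet Q → Q ⊆ K → (∀ y ∈ Q, ∀ z ∈ Q, ‖z - y‖ ≤ d) →
      ∀ φ : SmoothH1 n M,
      let E := (extChartAt (𝓡 n) x).source ∩ extChartAt (𝓡 n) x ⁻¹' Q
      ∫ p in E, φ.toFun p ^ 2 ∂riemannianVolume n M ≤
        C * d ^ 2 * ∫ p in E, ‖grad n φ.toFun p‖ ^ 2 ∂riemannianVolume n M +
          ((riemannianVolume n M).real E)⁻¹ * (∫ p in E, φ.toFun p ∂riemannianVolume n M) ^ 2 := by
  obtain ⟨C, hC, h⟩ := exists_poincare_constant (n := n) x hK hKt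
  refine ⟨C.toReal + 1, by positivity, fun Q d hd hQ hQm hQK hdiam φ => ?_⟩
  intro E
  have hlin := h Q d hQ hQm hQK hdiam φ.toFun φ.contMDiff
  have hφ : MemLp φ.toFun 2 ((riemannianVolume n M).restrict E) := φ.memLp.restrict E
  have hgm : MemLp (fun p => ‖grad n φ.toFun p‖) 2 ((riemannianVolume n M).restrict E) :=
    φ.memLp_grad.restrict E
  have hgrad : ∫⁻ p in E, ‖grad n φ.toFun p‖ₑ ^ 2 ∂riemannianVolume n M =
      ENNReal.ofReal (∫ p in E, ‖grad n φ.toFun p‖ ^ 2 ∂riemannianVolume n M) := by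
    rw [ofReal_integral_eq_lintegral_ofReal hgm.integrable_sq
      (Filter.Eventually.of_forall fun p => sq_nonneg _)]
    refine lintegral_congr fun p => ?_
    rw [ENNReal.ofReal_pow (norm_nonneg _), ofReal_norm]
  set G := ∫ p in E, ‖grad n φ.toFun p‖ ^ 2 ∂riemannianVolume n M with hG
  have hG0 : 0 ≤ G := integral_nonneg fun p => sq_nonneg _
  set m := (riemannianVolume n M).real E with hm
  have hm0 : 0 ≤ m := measureReal_nonneg
  simp only at hlin
  rw [lintegral_lintegral_enorm_sub_sq hφ, hgrad, ← ENNReal.ofReal_toReal hC,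
    ← ENNReal.ofReal_toReal (measure_ne_top (riemannianVolume n M) E),
    ← ENNReal.ofReal_pow hd.le, ← ENNReal.ofReal_mul (by positivity),
    ← ENNReal.ofReal_mul (by positivity), ← ENNReal.ofReal_mul (by positivity),
    ENNReal.ofReal_le_ofReal_iff (by positivity), measureReal_restrict_apply_univ] at hlin
  change 2 * (m * _ - _) ≤ C.toReal * d ^ 2 * m * G at hlin
  rcases hm0.eq_or_lt with h0 | hpos
  · have hE0 : riemannianVolume n M E = 0 := (measureReal_eq_zero_iff).1 h0.symm
    rw [Measure.restrict_eq_zero.2 hE0, integral_zero_measure]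
    positivity
  · rw [← sub_le_iff_le_add', inv_mul_eq_div, le_div_iff₀ hpos]
    have h1 : 0 ≤ d ^ 2 * m * G := by positivity
    have h2 : 0 ≤ C.toReal * (d ^ 2 * m * G) := by positivity
    linarith

/-- The local form of the compactness of `H¹ → L²`: near each point, the `L²` norm is controlled by
a small multiple of the `H¹` norm up to finitely many functionals on `L²`. -/
theorem exists_nhds_finiteRank_estimate (x : M) :
    ∃ W ∈ nhds x, MeasurableSet W ∧ ∀ ε > 0, ∃ (ι : Type) (_ : Fintype ι)
      (ℓ : ι → Lp ℝ 2 (riemannianVolume n M) →L[ℝ] ℝ), ∀ φ : SmoothH1 n M,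
        ∫ p in W, φ.toFun p ^ 2 ∂riemannianVolume n M ≤
          ε * ‖φ‖ ^ 2 + ∑ i, ℓ i (SmoothH1.toL2 φ) ^ 2 := by
  obtain ⟨r, hr, hrt⟩ := exists_closedBall_subset_target (n := n) x
  set K := Metric.closedBall (extChartAt (𝓡 n) x x) r with hKdef
  have hK : IsCompact K := isCompact_closedBall _ _
  obtain ⟨C, hC, hpoin⟩ := exists_poincare_constant_real x hK hrt
  set c : Set (EuclideanSpace ℝ (Fin n)) → Set M :=
    fun Q => (extChartAt (𝓡 n) x).source ∩ extChartAt (𝓡 n) x ⁻¹' Q with hc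
  have hcm {Q} (hQ : MeasurableSet Q) : MeasurableSet (c Q) :=
    measurableSet_source_inter_preimage x hQ
  refine ⟨c K, chart_closedBall_mem_nhds x hr, hcm hK.measurableSet, fun ε hε => ?_⟩
  -- The size of the grid is chosen such that the Poincaré constant `C d²` of the pieces is `ε`.
  set d : ℝ := √(ε / C) with hd
  have hd0 : 0 < d := Real.sqrt_pos.2 (by positivity)
  have hCd : C * d ^ 2 = ε := by
    rw [hd, Real.sq_sqrt (by positivity)]; field_simp
  obtain ⟨t, Q, hQ, hdisj, hcov⟩ := exists_finite_convex_partition hK.isBounded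
    (convex_closedBall _ _) hK.measurableSet hd0
  have hEm (k) : MeasurableSet (c (Q k)) := hcm (hQ k).2.1
  have hEdisj : (t : Set (Fin n → ℤ)).Pairwise (Function.onFun Disjoint fun k => c (Q k)) :=
    fun k _ l _ hkl => ((hdisj hkl).preimage _).mono inter_subset_right inter_subset_right
  refine ⟨t, inferInstance, fun k => √((riemannianVolume n M).real (c (Q k)))⁻¹ •
    innerSL ℝ (indicatorConstLp 2 (hEm k) (measure_ne_top _ _) (1 : ℝ)), fun φ => ?_⟩
  have hφ2 : Integrable (fun p => φ.toFun p ^ 2) (riemannianVolume n M) := φ.memLp.integrable_sq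
  have hg2 : Integrable (fun p => ‖grad n φ.toFun p‖ ^ 2) (riemannianVolume n M) :=
    φ.memLp_grad.integrable_sq
  have hfun (k : Fin n → ℤ) : (√((riemannianVolume n M).real (c (Q k)))⁻¹ •
      innerSL ℝ (indicatorConstLp 2 (hEm k) (measure_ne_top _ _) (1 : ℝ)))
        (SmoothH1.toL2 φ) ^ 2 = ((riemannianVolume n M).real (c (Q k)))⁻¹ *
          (∫ p in c (Q k), φ.toFun p ∂riemannianVolume n M) ^ 2 := by
    rw [smul_apply, smul_eq_mul, innerSL_apply_apply, L2.inner_indicatorConstLp_one, mul_pow,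
      Real.sq_sqrt (inv_nonneg.2 measureReal_nonneg)]
    congr 2
    exact setIntegral_congr_ae (hEm k) (φ.memLp.coeFn_toLp.mono fun p hp _ => hp)
  have hnorm : ∫ p, ‖grad n φ.toFun p‖ ^ 2 ∂riemannianVolume n M ≤ ‖φ‖ ^ 2 := by
    have h1 : ‖φ‖ ^ 2 = _ := (real_inner_self_eq_norm_sq φ).symm.trans (SmoothH1.inner_def φ φ)
    have h2 : 0 ≤ ∫ p, φ.toFun p * φ.toFun p ∂riemannianVolume n M :=
      integral_nonneg fun p => mul_self_nonneg _
    simp only [real_inner_self_eq_norm_sq] at h1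
    linarith
  have hcov' : c K ⊆ ⋃ k ∈ t, c (Q k) := fun p hp => by
    obtain ⟨k, hk, hpk⟩ := mem_iUnion₂.1 (hcov hp.2)
    exact mem_iUnion₂.2 ⟨k, hk, hp.1, hpk⟩
  calc ∫ p in c K, φ.toFun p ^ 2 ∂riemannianVolume n M
      ≤ ∫ p in ⋃ k ∈ t, c (Q k), φ.toFun p ^ 2 ∂riemannianVolume n M :=
        setIntegral_mono_set hφ2.integrableOn (Filter.Eventually.of_forall fun p => sq_nonneg _)
          hcov'.eventuallyLE
    _ = ∑ k ∈ t, ∫ p in c (Q k), φ.toFun p ^ 2 ∂riemannianVolume n M :=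
        integral_biUnion_finset t (fun k _ => hEm k) hEdisj fun k _ => hφ2.integrableOn
    _ ≤ ∑ k ∈ t, (C * d ^ 2 * ∫ p in c (Q k), ‖grad n φ.toFun p‖ ^ 2 ∂riemannianVolume n M +
          ((riemannianVolume n M).real (c (Q k)))⁻¹ *
            (∫ p in c (Q k), φ.toFun p ∂riemannianVolume n M) ^ 2) :=
        Finset.sum_le_sum fun k _ =>
          hpoin (Q k) d hd0 (hQ k).1 (hQ k).2.1 (hQ k).2.2.1 (hQ k).2.2.2 φ
    _ = ε * ∫ p in ⋃ k ∈ t, c (Q k), ‖grad n φ.toFun p‖ ^ 2 ∂riemannianVolume n M +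
          ∑ k ∈ t, ((riemannianVolume n M).real (c (Q k)))⁻¹ *
            (∫ p in c (Q k), φ.toFun p ∂riemannianVolume n M) ^ 2 := by
        rw [integral_biUnion_finset t (fun k _ => hEm k) hEdisj fun k _ => hg2.integrableOn,
          Finset.sum_add_distrib, Finset.mul_sum, hCd]
    _ ≤ ε * ‖φ‖ ^ 2 + ∑ k ∈ t, ((riemannianVolume n M).real (c (Q k)))⁻¹ *
            (∫ p in c (Q k), φ.toFun p ∂riemannianVolume n M) ^ 2 := by
        gcongr
        exact (setIntegral_le_integral hg2
          (Filter.Eventually.of_forall fun p => sq_nonneg _)).trans hnorm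
    _ = _ := by
        rw [← Finset.sum_coe_sort]
        simp only [hfun]

/-- The `L²` norm is bounded by an arbitrarily small multiple of the `H¹` norm up to finitely many
functionals. On smooth functions it is the sum of the local estimates, and it passes to the
completion. -/
theorem exists_finiteRank_estimate {ε : ℝ} (hε : 0 < ε) :
    ∃ (ι : Type u) (_ : Fintype ι) (ℓ : ι → H1 n M →L[ℝ] ℝ), ∀ u : H1 n M,
      ‖toL2 u‖ ^ 2 ≤ ε * ‖u‖ ^ 2 + ∑ i, ℓ i u ^ 2 := by
  choose W hWn hWm hW using exists_nhds_finiteRank_estimate (n := n) (M := M)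
  obtain ⟨t, -, ht⟩ := isCompact_univ.elim_nhds_subcover W fun x _ => hWn x
  set η : ℝ := ε / (t.card + 1) with hη
  choose ι hι ℓ hℓ using fun x => hW x η (by positivity)
  refine ⟨Σ x : t, ι x, inferInstance, fun i => (ℓ i.1 i.2).comp toL2, fun u => ?_⟩
  induction u using UniformSpace.Completion.induction_on with
  | hp => exact isClosed_le (by fun_prop) (by fun_prop)
  | ih φ =>
    have hφ2 : Integrable (fun p => φ.toFun p ^ 2) (riemannianVolume n M) := φ.memLp.integrable_sq
    have hcoe : toL2 (φ : H1 n M) = SmoothH1.toL2 φ :=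
      ContinuousLinearMap.fromCompletion_apply_coe _ _
    have hcov : (univ : Set M) ⊆ ⋃ x ∈ t, W x := ht
    have hsq : ‖toL2 (φ : H1 n M)‖ ^ 2 = ∫ p, φ.toFun p ^ 2 ∂riemannianVolume n M := by
      rw [hcoe]
      simp only [pow_two (φ.toFun _)]
      exact φ.norm_toLp_sq
    rw [hsq, Fintype.sum_sigma, UniformSpace.Completion.norm_coe]
    simp only [ContinuousLinearMap.comp_apply, hcoe]
    rw [Finset.sum_coe_sort t fun x => ∑ i, ℓ x i (SmoothH1.toL2 φ) ^ 2]
    have hind (x : M) : Integrable ((W x).indicator fun p => φ.toFun p ^ 2)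
        (riemannianVolume n M) := hφ2.indicator (hWm x)
    calc ∫ p, φ.toFun p ^ 2 ∂riemannianVolume n M
        ≤ ∫ p, ∑ x ∈ t, (W x).indicator (fun p => φ.toFun p ^ 2) p ∂riemannianVolume n M := by
          refine integral_mono hφ2 (integrable_finsetSum t fun x _ => hind x) fun p => ?_
          obtain ⟨x, hx, hpx⟩ := mem_iUnion₂.1 (hcov (mem_univ p))
          refine (indicator_of_mem hpx fun p => φ.toFun p ^ 2).symm.le.trans ?_
          exact Finset.single_le_sum (f := fun x => (W x).indicator (fun p => φ.toFun p ^ 2) p)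
            (fun z _ => indicator_nonneg (fun p _ => sq_nonneg (φ.toFun p)) p) hx
      _ = ∑ x ∈ t, ∫ p in W x, φ.toFun p ^ 2 ∂riemannianVolume n M := by
          rw [integral_finsetSum t fun x _ => hind x]
          exact Finset.sum_congr rfl fun x _ => integral_indicator (hWm x)
      _ ≤ ∑ x ∈ t, (η * ‖φ‖ ^ 2 + ∑ i, ℓ x i (SmoothH1.toL2 φ) ^ 2) :=
          Finset.sum_le_sum fun x _ => hℓ x φ
      _ ≤ _ := by
          rw [Finset.sum_add_distrib, Finset.sum_const, nsmul_eq_mul, ← mul_assoc]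
          gcongr
          rw [hη, mul_div_assoc', div_le_iff₀ (by positivity)]
          nlinarith

/-- Rellich's theorem: bounded sets of `H¹(M)` have totally bounded image in `L²(M)`. -/
theorem totallyBounded_image_toL2 {D : Set (H1 n M)} (hD : Bornology.IsBounded D) :
    TotallyBounded (toL2 '' D) :=
  totallyBounded_image_of_finiteRank_estimate toL2 (fun _ hε => exists_finiteRank_estimate hε) hD

end Rellich

/-! ### The Schrödinger form -/

section Form

variable {n : ℕ} {M : Type*} [TopologicalSpace M] [ChartedSpace (EuclideanSpace ℝ (Fin n)) M]
  [IsManifold (𝓡 n) ∞ M] [RiemannianBundle (fun x : M => TangentSpace (𝓡 n) x)]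
  [IsContMDiffRiemannianBundle (𝓡 n) ∞ (EuclideanSpace ℝ (Fin n))
    (fun x : M => TangentSpace (𝓡 n) x)]
  [MeasurableSpace M] [BorelSpace M]

theorem norm_toL2_le (u : H1 n M) : ‖toL2 u‖ ≤ ‖u‖ := by
  induction u using UniformSpace.Completion.induction_on with
  | hp => exact isClosed_le (by fun_prop) (by fun_prop)
  | ih φ =>
    have hcoe : toL2 (φ : H1 n M) = SmoothH1.toL2 φ :=
      ContinuousLinearMap.fromCompletion_apply_coe _ _
    rw [hcoe, UniformSpace.Completion.norm_coe, ← one_mul ‖φ‖]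
    exact φ.norm_toLp_le

variable {α : Type*} [MeasurableSpace α] {μ : Measure α}

theorem memLp_mul_of_bounded {V : α → ℝ} (hV : Measurable V) {C : ℝ} (hC : ∀ x, |V x| ≤ C)
    {f : α → ℝ} (hf : MemLp f 2 μ) : MemLp (fun x => V x * f x) 2 μ := by
  refine hf.of_le_mul (c := C) (hV.aestronglyMeasurable.mul hf.1)
    (Filter.Eventually.of_forall fun x => ?_)
  rw [norm_mul]
  gcongr
  exact hC x

/-- Multiplication by a bounded measurable function, as an operator on `L²`. -/
def mulL2 {V : α → ℝ} (hV : Measurable V) {C : ℝ} (hC : ∀ x, |V x| ≤ C) :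
    Lp ℝ 2 μ →L[ℝ] Lp ℝ 2 μ :=
  LinearMap.mkContinuous
    { toFun := fun f => (memLp_mul_of_bounded hV hC (Lp.memLp f)).toLp _
      map_add' := fun f g => by
        rw [← MemLp.toLp_add]
        refine MemLp.toLp_congr _ _ ?_
        filter_upwards [Lp.coeFn_add f g] with x hx
        simp only [hx, Pi.add_apply, mul_add]
      map_smul' := fun c f => by
        rw [RingHom.id_apply, ← MemLp.toLp_const_smul]
        refine MemLp.toLp_congr _ _ ?_
        filter_upwards [Lp.coeFn_smul c f] with x hx
        simp only [hx, Pi.smul_apply, smul_eq_mul]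
        ring } C fun f => by
      refine Lp.norm_le_mul_norm_of_ae_le_mul ?_
      filter_upwards [(memLp_mul_of_bounded hV hC (Lp.memLp f)).coeFn_toLp] with x hx
      simp only [LinearMap.coe_mk, AddHom.coe_mk, hx, norm_mul]
      gcongr
      exact hC x

theorem inner_mulL2 {V : α → ℝ} (hV : Measurable V) {C : ℝ} (hC : ∀ x, |V x| ≤ C)
    (f g : Lp ℝ 2 μ) : ⟪mulL2 hV hC f, g⟫ = ∫ x, V x * f x * g x ∂μ := by
  rw [L2.inner_def]
  refine integral_congr_ae ?_
  filter_upwards [(memLp_mul_of_bounded hV hC (Lp.memLp f)).coeFn_toLp] with x hx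
  have : mulL2 hV hC f x = V x * f x := hx
  simp [this, mul_comm]

variable {V : M → ℝ}

/-- The Schrödinger form as a continuous bilinear form on `H¹(M)`. -/
def schrodingerCLM (hV : Measurable V) {C : ℝ} (hC : ∀ x, |V x| ≤ C) : H1 n M →L[ℝ] H1 n M →L[ℝ] ℝ :=
  let ip : Lp ℝ 2 (riemannianVolume n M) →L[ℝ] Lp ℝ 2 (riemannianVolume n M) →L[ℝ] ℝ :=
    isBoundedBilinearMap_inner.toContinuousLinearMap
  isBoundedBilinearMap_inner.toContinuousLinearMap - ip.bilinearComp toL2 toL2 +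
    ip.bilinearComp ((mulL2 hV hC).comp toL2) toL2

theorem schrodingerCLM_apply (hV : Measurable V) {C : ℝ} (hC : ∀ x, |V x| ≤ C)
    (u v : H1 n M) :
    schrodingerCLM hV hC u v = schrodingerForm V u v := by
  rw [schrodingerForm, dirichletForm, ← inner_mulL2 hV hC]
  rfl

theorem schrodingerForm_symm (u v : H1 n M) : schrodingerForm V u v = schrodingerForm V v u := by
  rw [schrodingerForm, schrodingerForm, dirichletForm, dirichletForm, real_inner_comm,
    real_inner_comm (toL2 u)]
  simp only [mul_right_comm]

/-- Positivity of the potential makes the Schrödinger form coercive on `H¹(M)`. -/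
theorem schrodingerForm_coercive (hV : Measurable V) {C : ℝ} (hC : ∀ x, |V x| ≤ C)
    {c : ℝ} (hc : ∀ x, c ≤ V x) (u : H1 n M) :
    min c 1 * ‖u‖ ^ 2 ≤ schrodingerForm V u u := by
  have h1 : c * ‖toL2 u‖ ^ 2 ≤ ∫ x, V x * toL2 u x * toL2 u x ∂riemannianVolume n M := by
    rw [← real_inner_self_eq_norm_sq, L2.inner_def, ← integral_const_mul]
    refine integral_mono ((L2.integrable_inner (𝕜 := ℝ) (toL2 u) (toL2 u)).const_mul c) ?_
      fun x => ?_
    · exact (memLp_mul_of_bounded hV hC (Lp.memLp (toL2 u))).integrable_mul (Lp.memLp (toL2 u))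
    · simp only [real_inner_self_eq_norm_sq, Real.norm_eq_abs, sq_abs]
      nlinarith [hc x, sq_nonneg (toL2 u x)]
  have h2 : ‖toL2 u‖ ^ 2 ≤ ‖u‖ ^ 2 := by
    gcongr
    exact norm_toL2_le u
  rw [schrodingerForm, dirichletForm, real_inner_self_eq_norm_sq, real_inner_self_eq_norm_sq]
  have h3 : min c 1 * ‖toL2 u‖ ^ 2 ≤ c * ‖toL2 u‖ ^ 2 := by
    gcongr
    exact min_le_left _ _
  have h4 : min c 1 * (‖u‖ ^ 2 - ‖toL2 u‖ ^ 2) ≤ 1 * (‖u‖ ^ 2 - ‖toL2 u‖ ^ 2) :=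
    mul_le_mul_of_nonneg_right (min_le_right _ _) (sub_nonneg.2 h2)
  linarith

/-! ### The first eigenvalue -/

theorem IsEigenfunction.pos {l c : ℝ} (hc : 0 < c) (hcoer : ∀ u : H1 n M,
    c * ‖u‖ ^ 2 ≤ schrodingerForm V u u) {u : H1 n M} (hu : IsEigenfunction V l u) : 0 < l := by
  have h1 : 0 < c * ‖u‖ ^ 2 := by
    have := norm_pos_iff.2 hu.1
    positivity
  have h2 := h1.trans_le (hcoer u)
  rw [hu.2 u, real_inner_self_eq_norm_sq] at h2
  exact pos_of_mul_pos_left h2 (sq_nonneg _)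

/-- The first eigenvalue bounds the Rayleigh quotient from below. -/
theorem firstEigenvalue_mul_norm_sq_le [CompactSpace M] (hV : Measurable V) {C : ℝ}
    (hC : ∀ x, |V x| ≤ C) {c : ℝ} (hc0 : 0 < c)
    (hc : ∀ x, c ≤ V x) (v : H1 n M) :
    firstEigenvalue n V * ‖toL2 v‖ ^ 2 ≤ Q V v := by
  have hmin : 0 < min c 1 := lt_min hc0 one_pos
  have hcoer := schrodingerForm_coercive hV hC (n := n) hc
  have hQ : 0 ≤ Q V v := (by positivity : 0 ≤ min c 1 * ‖v‖ ^ 2).trans (hcoer v)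
  rcases eq_or_ne (toL2 (n := n) (M := M)) 0 with h0 | h0
  · simpa [h0] using hQ
  obtain ⟨l, u, hu0, hu, hmin'⟩ := exists_eigenvector_of_coercive (B := schrodingerCLM hV hC) toL2
    (fun D hD => totallyBounded_image_toL2 hD) h0 hmin
    (fun u v => by simpa only [schrodingerCLM_apply] using schrodingerForm_symm u v)
    (fun u => by simpa only [schrodingerCLM_apply] using hcoer u)
  simp only [schrodingerCLM_apply] at hu hmin'
  have hle : firstEigenvalue n V ≤ l :=
    csInf_le ⟨0, fun m ⟨w, hw⟩ => (hw.pos hmin hcoer).le⟩ ⟨u, hu0, hu⟩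
  calc firstEigenvalue n V * ‖toL2 v‖ ^ 2 ≤ l * ‖toL2 v‖ ^ 2 := by gcongr
    _ ≤ Q V v := hmin' v

/-! ### The admissible set and the minimizers -/

variable (n) in
theorem convex_H10 (A : Set M) : Convex ℝ (H10 n A) := by
  refine Convex.closure fun g ⟨U, hU, hAU, hg⟩ h ⟨U', hU', hAU', hh⟩ a b _ _ _ => ?_
  refine ⟨U ∩ U', hU.inter hU', Set.subset_inter hAU hAU', ?_⟩
  simp only [map_add, map_smul]
  filter_upwards [hg, hh, Lp.coeFn_add (a • toL2 g) (b • toL2 h), Lp.coeFn_smul a (toL2 g),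
    Lp.coeFn_smul b (toL2 h)] with x h1 h2 h3 h4 h5 hx
  rw [h3, Pi.add_apply, h4, h5, Pi.smul_apply, Pi.smul_apply, h1 hx.1, h2 hx.2, smul_zero,
    smul_zero, add_zero]

/-- The mean of a function in `H¹(M)` as a continuous linear functional; here the finiteness of the
volume enters. -/
def meanCLM [CompactSpace M] : H1 n M →L[ℝ] ℝ :=
  (innerSL ℝ (indicatorConstLp 2 MeasurableSet.univ
    (measure_ne_top (riemannianVolume n M) Set.univ) (1 : ℝ))).comp toL2

theorem meanCLM_apply [CompactSpace M] (u : H1 n M) :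
    meanCLM u = ∫ x, toL2 u x ∂riemannianVolume n M := by
  rw [meanCLM, ContinuousLinearMap.comp_apply, innerSL_apply_apply, L2.inner_indicatorConstLp_one,
    Measure.restrict_univ]

theorem admissible_eq [CompactSpace M] (e₁ : H1 n M) (A : Set M) :
    admissible e₁ A = meanCLM ⁻¹' {0} ∩ (fun u => u + -e₁) ⁻¹' H10 n A := by
  ext u
  simp only [admissible, Set.mem_ofPred_eq, Set.mem_inter_iff, Set.mem_preimage,
    Set.mem_singleton_iff, meanCLM_apply, sub_eq_add_neg]

theorem convex_admissible [CompactSpace M] (e₁ : H1 n M) (A : Set M) :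
    Convex ℝ (admissible e₁ A) := by
  rw [admissible_eq]
  exact ((convex_singleton 0).is_linear_preimage meanCLM.toLinearMap.isLinear).inter
    ((convex_H10 n A).translate_preimage_left (-e₁))

theorem isClosed_admissible [CompactSpace M] (e₁ : H1 n M) (A : Set M) :
    IsClosed (admissible e₁ A) := by
  rw [admissible_eq]
  exact (isClosed_singleton.preimage meanCLM.continuous).inter
    (isClosed_closure.preimage (continuous_add_const (-e₁)))

theorem isCapMinimizer_iff {e₁ : H1 n M} {A : Set M} {u : H1 n M} :
    IsCapMinimizer V e₁ A u ↔ u ∈ admissible e₁ A ∧ ∀ v ∈ admissible e₁ A, Q V u ≤ Q V v := by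
  refine and_congr_right fun hu => ⟨fun h v hv => ?_, fun h => le_antisymm ?_ ?_⟩
  · exact EReal.coe_le_coe_iff.1 (h.trans_le (iInf₂_le v hv))
  · exact le_iInf₂ fun v hv => EReal.coe_le_coe_iff.2 (h v hv)
  · exact iInf₂_le u hu

end Form

end Schrodinger

end

theorem mainTheorem4 (n : ℕ) (hn : 1 ≤ n) (M : Type*) [TopologicalSpace M] [T2Space M]
    [CompactSpace M] [ChartedSpace (EuclideanSpace ℝ (Fin n)) M] [IsManifold (𝓡 n) ∞ M]
    [RiemannianBundle (fun x : M => TangentSpace (𝓡 n) x)]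
    [IsContMDiffRiemannianBundle (𝓡 n) ∞ (EuclideanSpace ℝ (Fin n))
      (fun x : M => TangentSpace (𝓡 n) x)]
    [MeasurableSpace M] [BorelSpace M]
    (V : M → ℝ) (hV : Measurable V) (hVb : ∃ C : ℝ, ∀ x, |V x| ≤ C)
    (hVpos : ∃ c : ℝ, 0 < c ∧ ∀ x, c ≤ V x)
    (e₁ : Schrodinger.H1 n M)
    (he₁ : Schrodinger.IsEigenfunction V (Schrodinger.firstEigenvalue n V) e₁) (A : Set M) :
    ((Schrodinger.admissible e₁ A).Nonempty →
      ∃! u : Schrodinger.H1 n M, Schrodinger.IsCapMinimizer V e₁ A u) ∧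
    ∀ u : Schrodinger.H1 n M, Schrodinger.IsCapMinimizer V e₁ A u →
      ((‖Schrodinger.toL2 u‖ ^ 2 : ℝ) : EReal) ≤
        Schrodinger.cap V e₁ A / (Schrodinger.firstEigenvalue n V : EReal) := by
  obtain ⟨C, hC⟩ := hVb
  obtain ⟨c, hc0, hc⟩ := hVpos
  have hmin : 0 < min c 1 := lt_min hc0 one_pos
  have hcoer := Schrodinger.schrodingerForm_coercive hV hC (n := n) hc
  have hcoer' (u : Schrodinger.H1 n M) :
      min c 1 * ‖u‖ ^ 2 ≤ Schrodinger.schrodingerCLM hV hC u u := by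
    rw [Schrodinger.schrodingerCLM_apply]; exact hcoer u
  have hconv := Schrodinger.convex_admissible e₁ A
  refine ⟨fun hne => ?_, fun u hu => ?_⟩
  · obtain ⟨u, huA, hu⟩ := Schrodinger.exists_isMinOn_of_coercive hmin hcoer'
      (Schrodinger.isClosed_admissible e₁ A) hconv hne
    have hQ (w : Schrodinger.H1 n M) :
        Schrodinger.schrodingerCLM hV hC w w = Schrodinger.Q V w :=
      Schrodinger.schrodingerCLM_apply hV hC w w
    refine ⟨u, Schrodinger.isCapMinimizer_iff.2 ⟨huA, by simpa only [hQ] using hu⟩,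
      fun v hv => ?_⟩
    obtain ⟨hvA, hv⟩ := Schrodinger.isCapMinimizer_iff.1 hv
    exact Schrodinger.eq_of_isMinOn_of_coercive hmin hcoer' hconv hvA huA
      (by simpa only [hQ] using hv) hu
  · have hpos := he₁.pos hmin hcoer
    rw [← hu.2, ← EReal.coe_div, EReal.coe_le_coe_iff, le_div_iff₀ hpos, mul_comm]
    exact Schrodinger.firstEigenvalue_mul_norm_sq_le hV hC hc0 hc u
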